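/- **Setting.** For each $x\in\mathbb R^d$ ($d\ge 1$) let $\Xi(x)$ be a probability law on a measurable space, depending measurably on $x$, let $F(x;\xi)$ be a jointly measurable real function, and let $f(x)=\mathbb E_{\xi\sim\Xi(x)}[F(x;\xi)]$. One query of the stochastic zeroth-order oracle (SZO) at $x$ draws a fresh $\xi\sim\Xi(x)$ and returns $F(x;\xi)$. Assume that for all $x,y\in\mathbb R^d$, in the Euclidean norm: 1. $F(x;\cdot)$ is square integrable under $\Xi(x)$ and $\mathbb E_{\xi\sim\Xi(x)}[|F(x;\xi)-f(x)|^2]\le\sigma^2$; 2. $f^*=\inf f>-\infty$, and $f(0)-f^*\le\gamma$; 3. $|f(x)-f(y)|\le L\|x-y\|$; 4. $f$ is differentiable and $\|\nabla f(x)-\nabla f(y)\|\le L_g\|x-y\|$, where $L_g>0$. **Algorithm ZO-O2NC.** Inputs: $\delta>0$, integers $M,K\ge1$, $\eta>0$, Option I or II. Put $D=\delta/M$, $T=KM$ and $x_0=y_0=0$. In Option II, first draw $u_0$ uniformly on the unit sphere $\mathbb S^{d-1}$ and query $h_0$ at $y_0+\delta u_0$. For $t=1,\dots,T$: - if $t\equiv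 1 \pmod M$, so that a new block of $M$ rounds begins, set $\Delta_t=0$; - draw $s_t$ uniformly in $[0,1]$, and set $y_t=x_{t-1}+s_t\Delta_t$ and $x_t=x_{t-1}+\Delta_t$; - draw $u_t$ uniformly on $\mathbb S^{d-1}$; - in Option I, query values $h_t^{+}$ and $h_t^{-}$ independently at $y_t+\delta u_t$ and $y_t-\delta u_t$, and set $g_t=\frac{d}{2\delta}(h_t^+-h_t^-)u_t$; - in Option II, query $h_t$ at $y_t+\delta u_t$, and set $g_t=\frac d\delta(h_t-h_{t-1})u_t$; - let $\Delta_{t+1}$ be the Euclidean projection of $\Delta_t-\eta g_t$ onto the closed ball of radius $D$ about $0$. (For $M=1$ every round begins a block.) Draw $k_{\rm out}$ uniformly in $\{1,\dots,K\}$, independently of everything else, and return $\bar y=\frac1M\sum_{t=(k_{\rm out}-1)M+1}^{k_{\rm out}M}y_t$. The number of SZO queries is $N_{\rm SZO}=2T$ in Option I and $N_{\rm SZO}=T+1$ in Option II. **Theorem 4.2.** Let $\gamma,\sigma,L\ge0$, $L_g>0$ and $\epsilon_0>0$. There is a constant $C>0$, depending only on $\gamma,\sigma,L,L_g,\epsilon_0$,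 such that for Option I and for Option II, for every dimension $d\ge1$ and every $0<\epsilon\le\epsilon_0$, there are $M,K\ge1$ and $\eta>0$, chosen before the problem instance, with $$N_{\rm SZO}\le C\,d^2\epsilon^{-6},$$ and such that for every problem satisfying 1–4, ZO-O2NC run with $\delta=\epsilon/(4L_g)$ and these $M,K,\eta$ returns a point $\bar y$ with $$\mathbb E\,\|\nabla f(\bar y)\|\le\epsilon .$$ -/

import Mathlib

open MeasureTheory ProbabilityTheory
open scoped Gradient

noncomputable section

namespace ZOO2NC

/-- The decision space `ℝ^d` with its Euclidean norm. -/
abbrev Vec (d : ℕ) : Type := EuclideanSpace ℝ (Fin d)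

/-! ### The decision-dependent problem and its oracle -/

/-- A decision-dependent stochastic problem on `ℝ^d`: the sampling law `Ξ x` of the data depends on
the decision `x`, and `F x ξ` is the observed function value. -/
structure Problem (d : ℕ) (S : Type*) [MeasurableSpace S] where
  Ξ : Kernel (Vec d) S
  isMarkov : IsMarkovKernel Ξ
  F : Vec d → S → ℝ
  measurable_F : Measurable (Function.uncurry F)

namespace Problem

variable {d : ℕ} {S : Type*} [MeasurableSpace S] (P : Problem d S)

instance : IsMarkovKernel P.Ξ := P.isMarkov

/-- The objective `f x = 𝔼_{ξ ∼ Ξ x} [F x ξ]`. -/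
def objective (x : Vec d) : ℝ := ∫ ξ, P.F x ξ ∂(P.Ξ x)

/-- The oracle is unbiased for the objective (the expectation exists) with variance at most
`σ ^ 2` at every decision. -/
def OracleVarianceLE (σ : ℝ) : Prop :=
  ∀ x, MemLp (P.F x) 2 (P.Ξ x) ∧ ∫ ξ, |P.F x ξ - P.objective x| ^ 2 ∂(P.Ξ x) ≤ σ ^ 2

/-- One oracle query at `x`: draw a fresh `ξ ∼ Ξ x` and return the value `F x ξ`. -/
def query : Kernel (Vec d) ℝ := (Kernel.id ×ₖ P.Ξ).map (Function.uncurry P.F)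

instance : IsMarkovKernel P.query := Kernel.IsMarkovKernel.map _ P.measurable_F

theorem query_apply (x : Vec d) : P.query x = (P.Ξ x).map (P.F x) := by
  have h : Measurable (Prod.mk x : S → Vec d × S) := measurable_prodMk_left
  rw [query, Kernel.map_apply _ P.measurable_F, Kernel.prod_apply, Kernel.id_apply,
    Measure.dirac_prod, Measure.map_map P.measurable_F h]
  rfl

end Problem

/-! ### Sampling primitives -/

/-- The uniform distribution on the unit sphere of `ℝ^d`. -/
def sphereUniform (d : ℕ) : Measure (Metric.sphere (0 : Vec d) 1) :=
  ProbabilityTheory.cond (volume : Measure (Vec d)).toSphere Set.univ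

instance (d : ℕ) [NeZero d] : IsProbabilityMeasure (sphereUniform d) :=
  cond_isProbabilityMeasure <| by
    rw [Ne, Measure.measure_univ_eq_zero]
    exact Measure.toSphere_ne_zero _

/-- The uniform distribution on `[0, 1]`. -/
def unitUniform : Measure ℝ := volume.restrict (Set.Icc 0 1)

instance : IsProbabilityMeasure unitUniform := ⟨by simp [unitUniform]⟩

/-- Independent samples from `κ a i`, for `i` in a finite index set. -/
def piKernel {α ι : Type*} [MeasurableSpace α] [Fintype ι] (κ : ι → Kernel α ℝ)
    [∀ i, IsMarkovKernel (κ i)] : Kernel α (ι → ℝ) where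
  toFun a := Measure.pi fun i => κ i a
  measurable' := by
    refine Measurable.measure_of_isPiSystem_of_isProbabilityMeasure generateFrom_pi.symm
      isPiSystem_pi ?_
    rintro _ ⟨s, hs, rfl⟩
    simp only [Measure.pi_pi]
    exact Finset.measurable_prod _ fun i _ => (κ i).measurable_coe (hs i (Set.mem_univ i))

instance {α ι : Type*} [MeasurableSpace α] [Fintype ι] (κ : ι → Kernel α ℝ)
    [∀ i, IsMarkovKernel (κ i)] : IsMarkovKernel (piKernel κ) :=
  ⟨fun a => by change IsProbabilityMeasure (Measure.pi fun i => κ i a); infer_instance⟩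

/-- The Euclidean projection onto the closed ball of radius `r` about the origin. -/
def ballProj {d : ℕ} (r : ℝ) (v : Vec d) : Vec d := if ‖v‖ ≤ r then v else (r / ‖v‖) • v

theorem ballProj_mem {d : ℕ} {r : ℝ} (hr : 0 ≤ r) (v : Vec d) :
    ballProj r v ∈ Metric.closedBall (0 : Vec d) r := by
  rw [mem_closedBall_zero_iff, ballProj]
  split_ifs with h
  · exact h
  · have hv : 0 < ‖v‖ := lt_of_le_of_lt hr (not_le.mp h)
    rw [norm_smul, Real.norm_of_nonneg (by positivity), div_mul_cancel₀ _ hv.ne']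

theorem ballProj_nearest {d : ℕ} {r : ℝ} (hr : 0 ≤ r) (v w : Vec d)
    (hw : w ∈ Metric.closedBall (0 : Vec d) r) : ‖v - ballProj r v‖ ≤ ‖v - w‖ := by
  rw [mem_closedBall_zero_iff] at hw
  rw [ballProj]
  split_ifs with h
  · simp
  · have h' := not_le.mp h
    have hv : 0 < ‖v‖ := lt_of_le_of_lt hr h'
    have e : v - (r / ‖v‖) • v = ((‖v‖ - r) / ‖v‖) • v := by
      rw [sub_div, div_self hv.ne', sub_smul, one_smul]
    rw [e, norm_smul, Real.norm_of_nonneg (div_nonneg (by linarith) hv.le),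
      div_mul_cancel₀ _ hv.ne']
    linarith [norm_sub_norm_le v w]

@[fun_prop]
theorem measurable_ballProj {d : ℕ} (r : ℝ) : Measurable (ballProj r : Vec d → Vec d) :=
  Measurable.ite (measurableSet_le measurable_norm measurable_const) measurable_id (by fun_prop)

/-! ### The algorithm -/

/-- The choice of gradient estimator: two-point feedback (Option I), or one-point residual feedback
(Option II). -/
inductive Feedback
  | twoPoint
  | onePoint

/-- Number of oracle queries made before the first round. -/
@[reducible] def Feedback.initQueries : Feedback → ℕ
  | .twoPoint => 0
  | .onePoint => 1

/-- Number of oracle queries made in each round. -/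
@[reducible] def Feedback.roundQueries : Feedback → ℕ
  | .twoPoint => 2
  | .onePoint => 1

/-- Total number of oracle queries made by a run of `T` rounds. -/
def Feedback.totalQueries (opt : Feedback) (T : ℕ) : ℕ :=
  opt.initQueries + ∑ _t ∈ Finset.Icc 1 T, opt.roundQueries

/-- The decisions queried in a round with point `y`, smoothing radius `δ` and direction `u`. -/
def queryPoint {d : ℕ} (δ : ℝ) (y u : Vec d) : (opt : Feedback) → Fin opt.roundQueries → Vec d
  | .twoPoint => ![y + δ • u, y - δ • u]
  | .onePoint => ![y + δ • u]

/-- The gradient estimator, from the direction `u`, the values `v` returned in this round and the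
last value `h` returned before this round. -/
def estimator {d : ℕ} (δ : ℝ) (u : Vec d) (h : ℝ) :
    (opt : Feedback) → (Fin opt.roundQueries → ℝ) → Vec d
  | .twoPoint, v => ((d : ℝ) / (2 * δ) * (v 0 - v 1)) • u
  | .onePoint, v => ((d : ℝ) / δ * (v 0 - h)) • u

/-- The value stored for use in the next round (none is needed with two-point feedback). -/
def storedValue : (opt : Feedback) → (Fin opt.roundQueries → ℝ) → ℝ
  | .twoPoint, _ => 0
  | .onePoint, v => v 0

/-- State after round `t`: `(x_t, Δ_{t+1}, y_t, g_t, h_t)`, with `h_t` the stored oracle value. Here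
`Δ_{t+1}` is the outcome of the projection step; it is reset to `0` when a new block begins. -/
abbrev State (d : ℕ) : Type := Vec d × Vec d × Vec d × Vec d × ℝ

namespace State

variable {d : ℕ} (z : State d)

/-- The iterate `x_t`. -/
abbrev x : Vec d := z.1
/-- The next increment `Δ_{t+1}`, before a possible reset. -/
abbrev Δ : Vec d := z.2.1
/-- The evaluation point `y_t`. -/
abbrev y : Vec d := z.2.2.1
/-- The gradient estimate `g_t`. -/
abbrev g : Vec d := z.2.2.2.1
/-- The stored oracle value `h_t`. -/
abbrev h : ℝ := z.2.2.2.2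

end State

/-- The increment used in round `t + 1`: it is reset to `0` at the start of each block, that is,
when the number `t` of completed rounds is a multiple of the block length `M`. -/
def increment {d : ℕ} (M t : ℕ) (z : State d) : Vec d := if M ∣ t then 0 else z.Δ

/-- The evaluation point of round `t + 1`, for interpolation parameter `s`. -/
def evalPoint {d : ℕ} (M t : ℕ) (z : State d) (s : ℝ) : Vec d := z.x + s • increment M t z

/-- The state after round `t + 1`, from the state `z` after round `t`, the interpolation parameter
`s`, the direction `u` and the oracle values `v` of this round. -/
def update {d : ℕ} (opt : Feedback) (δ : ℝ) (M : ℕ) (η : ℝ) (t : ℕ) (z : State d) (s : ℝ)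
    (u : Vec d) (v : Fin opt.roundQueries → ℝ) : State d :=
  (z.x + increment M t z,
    ballProj (δ / M) (increment M t z - η • estimator δ u z.h opt v),
    evalPoint M t z s,
    estimator δ u z.h opt v,
    storedValue opt v)

@[fun_prop]
theorem measurable_increment {d : ℕ} (M t : ℕ) :
    Measurable (increment M t : State d → Vec d) := by
  unfold increment
  split_ifs <;> fun_prop

theorem measurable_queryPoint {d : ℕ} (opt : Feedback) (δ : ℝ) (M t : ℕ)
    (i : Fin opt.roundQueries) :
    Measurable fun p : State d × ℝ × Metric.sphere (0 : Vec d) 1 =>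
      queryPoint δ (evalPoint M t p.1 p.2.1) p.2.2 opt i := by
  unfold evalPoint
  cases opt
  · fin_cases i <;> simp only [queryPoint] <;> simp <;> fun_prop
  · fin_cases i; simp only [queryPoint]; simp; fun_prop

theorem measurable_update {d : ℕ} (opt : Feedback) (δ : ℝ) (M : ℕ) (η : ℝ) (t : ℕ) :
    Measurable fun p : State d × (ℝ × Metric.sphere (0 : Vec d) 1) × (Fin opt.roundQueries → ℝ) =>
      update opt δ M η t p.1 p.2.1.1 p.2.1.2 p.2.2 := by
  unfold update evalPoint
  cases opt <;> simp only [estimator, storedValue] <;> fun_prop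

variable {d : ℕ} [NeZero d] {S : Type*} [MeasurableSpace S]

/-- The oracle values of round `t + 1`, given the state after round `t`, the interpolation
parameter and the direction: one independent query at each queried decision. -/
def roundValues (P : Problem d S) (opt : Feedback) (δ : ℝ) (M t : ℕ) :
    Kernel (State d × ℝ × Metric.sphere (0 : Vec d) 1) (Fin opt.roundQueries → ℝ) :=
  piKernel fun i => P.query.comap _ (measurable_queryPoint opt δ M t i)

instance (P : Problem d S) (opt : Feedback) (δ : ℝ) (M t : ℕ) :
    IsMarkovKernel (roundValues P opt δ M t) := by
  unfold roundValues; infer_instance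

/-- Round `t + 1` of the algorithm as a Markov kernel on states: sample `s` uniformly in `[0, 1]`
and `u` uniformly on the sphere, query the oracle, and update the state. -/
def roundKernel (P : Problem d S) (opt : Feedback) (δ : ℝ) (M : ℕ) (η : ℝ) (t : ℕ) :
    Kernel (State d) (State d) :=
  (Kernel.id ×ₖ (Kernel.const (State d) (unitUniform.prod (sphereUniform d)) ⊗ₖ
    roundValues P opt δ M t)).map fun p => update opt δ M η t p.1 p.2.1.1 p.2.1.2 p.2.2

instance (P : Problem d S) (opt : Feedback) (δ : ℝ) (M : ℕ) (η : ℝ) (t : ℕ) :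
    IsMarkovKernel (roundKernel P opt δ M η t) :=
  Kernel.IsMarkovKernel.map _ (measurable_update opt δ M η t)

/-- The law of the state before the first round. All vectors start at `0`; with one-point feedback
an initialization query at `δ • u₀`, with `u₀` uniform on the sphere, provides the stored value. -/
def initialLaw (P : Problem d S) (δ : ℝ) : Feedback → Measure (State d)
  | .twoPoint => Measure.dirac (0, 0, 0, 0, 0)
  | .onePoint =>
      (P.query ∘ₘ (sphereUniform d).map fun u : Metric.sphere (0 : Vec d) 1 =>
        (0 : Vec d) + δ • (u : Vec d)).map fun h => (0, 0, 0, 0, h)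

instance (P : Problem d S) (δ : ℝ) (opt : Feedback) :
    IsProbabilityMeasure (initialLaw P δ opt) := by
  cases opt
  · unfold initialLaw; infer_instance
  · have : IsProbabilityMeasure
        ((sphereUniform d).map fun u : Metric.sphere (0 : Vec d) 1 =>
          (0 : Vec d) + δ • (u : Vec d)) :=
      Measure.isProbabilityMeasure_map (by fun_prop)
    exact Measure.isProbabilityMeasure_map (by fun_prop)

/-- The law of the sequence of states of the algorithm with smoothing radius `δ`, block length `M`
and stepsize `η`. A run of `T` rounds consists of the states of index at most `T`. -/
def runLaw (P : Problem d S) (opt : Feedback) (δ : ℝ) (M : ℕ) (η : ℝ) : Measure (ℕ → State d) :=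
  Kernel.trajMeasure (X := fun _ => State d) (initialLaw P δ opt) fun t =>
    (roundKernel P opt δ M η t).comap (fun past => past ⟨t, Finset.mem_Iic.mpr le_rfl⟩)
      (measurable_pi_apply _)

instance (P : Problem d S) (opt : Feedback) (δ : ℝ) (M : ℕ) (η : ℝ) :
    IsProbabilityMeasure (runLaw P opt δ M η) := by
  unfold runLaw; infer_instance

/-- The average of the evaluation points of block `k`, for `k = 1, 2, …`. -/
def blockAverage {d : ℕ} (M : ℕ) (ω : ℕ → State d) (k : ℕ) : Vec d :=
  (1 / (M : ℝ)) • ∑ t ∈ Finset.Icc ((k - 1) * M + 1) (k * M), (ω t).y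

/-- The joint law of the run and of the independent output index, uniform on `{1, …, K}`. The
output of the algorithm is `blockAverage M ω k` for `(ω, k)` drawn from this law. -/
def outputLaw (P : Problem d S) (opt : Feedback) (δ : ℝ) (M K : ℕ) (η : ℝ) :
    Measure ((ℕ → State d) × ℕ) :=
  (runLaw P opt δ M η).prod (uniformOn (Set.Icc 1 K))

end ZOO2NC

end

/-! The proof converts online regret into stationarity. Since `y_t` is uniform on the segment from
`x_{t-1}` to `x_t`, the conditional mean of `⟨∇f(y_t), Δ_t⟩` is exactly `f(x_t) - f(x_{t-1})`
(`integral_inner_gradient_increment`), and these differences telescope. Within a block the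
increments are the iterates of projected online gradient descent on the ball of radius `D = δ/M`.
Comparing them with the point of that ball opposite to the sum `N` of the block's gradients bounds
`D ‖N‖` by the decrease of `f` plus three errors: bias, regret and noise.

Bias: both estimators have conditional mean `smoothedGrad`, which is within `Lg δ` of the gradient
(`norm_smoothedGrad_sub_gradient_le`). In Option II the old value drops out because it is fixed by
the past and `u_t` has mean zero. Only the mean and variance of the oracle at the queried decision
enter, so the dependence of the sampling law on the decision does no harm.

Regret and noise: the second moments of `g_t` and of its error are at most `V = noiseLevel`, of
order `d²/δ²`. The comparator depends on the whole block, so its pairing with the noise has no zero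
mean; it is bounded by `D` times the norm of the summed errors, which are orthogonal martingale
differences. For any `s` with `M V ≤ s²` and `η = D/s`, regret and noise together cost `2 D s`.

Since `M D = δ`, the points of a block lie within `δ` of each other, and replacing the average
gradient by the gradient at the average point costs another `Lg δ`. Averaging over blocks gives
`γ/(δK) + 3 Lg δ + 2s/M` (`integral_outputLaw_le`). At `δ = ε/(4 Lg)` the middle term is `3ε/4`; the
others are at most `ε/8` each for `M` of order `d² ε⁻⁴` and `K` of order `ε⁻²`, hence the `d² ε⁻⁶`
queries. -/

noncomputable section

namespace ZOO2NC

/-! ### Symmetry of the sphere and the bias of spherical smoothing. -/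

section Sphere

variable {d : ℕ}

-- The surface measure of a set is a multiple of the volume of the cone over it. A linear isometry
-- preserves volume and maps cones to cones.
open scoped Pointwise in
theorem map_coe_sphereUniform_isometry (Φ : Vec d ≃ₗᵢ[ℝ] Vec d) :
    ((sphereUniform d).map (↑)).map Φ = (sphereUniform d).map ((↑) : _ → Vec d) := by
  ext s hs
  have hc : Measurable ((↑) : Metric.sphere (0 : Vec d) 1 → Vec d) := measurable_subtype_coe
  have hΦ : Measurable Φ := Φ.continuous.measurable
  rw [Measure.map_apply hΦ hs, Measure.map_apply hc (hΦ hs), Measure.map_apply hc hs,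
    sphereUniform, cond_apply MeasurableSet.univ, cond_apply MeasurableSet.univ,
    Set.univ_inter, Set.univ_inter, Measure.toSphere_apply' _ (hc (hΦ hs)),
    Measure.toSphere_apply' _ (hc hs)]
  congr 2
  rw [← Φ.measurePreserving.measure_preimage_equiv (f := Φ.toMeasurableEquiv)
      (Set.Ioo (0 : ℝ) 1 • (((↑) : Metric.sphere (0 : Vec d) 1 → Vec d) ''
        (((↑) : Metric.sphere (0 : Vec d) 1 → Vec d) ⁻¹' s)) :
        Set (Vec d))]
  congr 1
  ext v
  simp only [Set.mem_smul, Set.mem_image, Set.mem_preimage, Subtype.exists,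
    mem_sphere_zero_iff_norm, LinearIsometryEquiv.coe_toMeasurableEquiv]
  constructor
  · rintro ⟨r, hr, _, ⟨u, hu, hus, rfl⟩, rfl⟩
    exact ⟨r, hr, Φ u, ⟨Φ u, by simpa using hu, hus, rfl⟩, by simp⟩
  · rintro ⟨r, hr, _, ⟨u, hu, hus, rfl⟩, h⟩
    refine ⟨r, hr, Φ.symm u, ⟨Φ.symm u, by simpa using hu, by simpa using hus, rfl⟩, ?_⟩
    apply Φ.injective
    simpa using h

theorem integral_sphereUniform_isometry {E : Type*} [NormedAddCommGroup E] [NormedSpace ℝ E]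
    (Φ : Vec d ≃ₗᵢ[ℝ] Vec d) (φ : Vec d → E) :
    ∫ u, φ (Φ u) ∂(sphereUniform d) = ∫ u, φ u ∂(sphereUniform d) := by
  have hc : MeasurableEmbedding ((↑) : Metric.sphere (0 : Vec d) 1 → Vec d) :=
    MeasurableEmbedding.subtype_coe Metric.isClosed_sphere.measurableSet
  have hΦ : MeasurableEmbedding Φ := Φ.toMeasurableEquiv.measurableEmbedding
  rw [← hc.integral_map (fun v => φ (Φ v)), ← hc.integral_map φ,
    ← hΦ.integral_map φ, map_coe_sphereUniform_isometry]

theorem integrable_sphereUniform [NeZero d] {E : Type*} [NormedAddCommGroup E] {φ : Vec d → E}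
    [SecondCountableTopology E] (hφ : Continuous φ) :
    Integrable (fun u : Metric.sphere (0 : Vec d) 1 => φ u) (sphereUniform d) := by
  have : CompactSpace (Metric.sphere (0 : Vec d) 1) :=
    isCompact_iff_compactSpace.mp (isCompact_sphere _ _)
  have hc : Continuous (fun u : Metric.sphere (0 : Vec d) 1 => φ u) := by fun_prop
  exact hc.integrable_of_hasCompactSupport (HasCompactSupport.of_compactSpace _)

theorem integral_sphereUniform_coe : ∫ u, (u : Vec d) ∂(sphereUniform d) = 0 := by
  have h := integral_sphereUniform_isometry (LinearIsometryEquiv.neg ℝ) (fun v : Vec d => v)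
  simp only [LinearIsometryEquiv.coe_neg, integral_neg] at h
  have h2 : (2 : ℝ) • ∫ u, (u : Vec d) ∂(sphereUniform d) = 0 := by
    rw [two_smul]
    nth_rw 1 [← h]
    simp
  simpa using h2

/-- The reflection in the hyperplane orthogonal to `v - w` exchanges `v` and `w`. -/
theorem integral_sphereUniform_inner_sq_eq {v w : Vec d} (h : ‖v‖ = ‖w‖) :
    ∫ u, inner ℝ (u : Vec d) v ^ 2 ∂(sphereUniform d)
      = ∫ u, inner ℝ (u : Vec d) w ^ 2 ∂(sphereUniform d) := by
  let R := (ℝ ∙ (v - w))ᗮ.reflection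
  have hR : R v = w := Submodule.reflection_sub h
  rw [← integral_sphereUniform_isometry R fun u => inner ℝ u w ^ 2]
  simp_rw [← hR, LinearIsometryEquiv.inner_map_map]

/-- All unit directions give the same value, and over an orthonormal basis the values sum to the
mean of `‖u‖²`, which is one. -/
theorem integral_sphereUniform_inner_sq [NeZero d] {w : Vec d} (hw : ‖w‖ = 1) :
    ∫ u, inner ℝ (u : Vec d) w ^ 2 ∂(sphereUniform d) = 1 / d := by
  have h1 : ∑ i : Fin d, ∫ u, inner ℝ (u : Vec d) (EuclideanSpace.single i (1 : ℝ)) ^ 2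
      ∂(sphereUniform d) = 1 := by
    rw [← integral_finsetSum _ fun i _ => integrable_sphereUniform
      (φ := fun u => inner ℝ u (EuclideanSpace.single i (1 : ℝ)) ^ 2) (by fun_prop)]
    rw [integral_congr_ae (g := fun _ => (1 : ℝ)), integral_const]
    · simp
    · refine .of_forall fun u => ?_
      have hu : ‖(u : Vec d)‖ = 1 := by simp
      have := EuclideanSpace.real_norm_sq_eq (u : Vec d)
      rw [hu] at this
      simp [EuclideanSpace.inner_single_right, ← this]
  have h2 : ∀ i : Fin d, ∫ u, inner ℝ (u : Vec d) (EuclideanSpace.single i (1 : ℝ)) ^ 2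
      ∂(sphereUniform d) = ∫ u, inner ℝ (u : Vec d) w ^ 2 ∂(sphereUniform d) := fun i =>
    integral_sphereUniform_inner_sq_eq (by simp [hw])
  simp only [h2, Finset.sum_const, Finset.card_univ, Fintype.card_fin, nsmul_eq_mul] at h1
  rw [eq_div_iff (by exact_mod_cast NeZero.ne d)]
  linarith

/-- The mean of the zeroth-order gradient estimator at `x` with exact function values. -/
def smoothedGrad (δ : ℝ) (f : Vec d → ℝ) (x : Vec d) : Vec d :=
  ((d : ℝ) / δ) • ∫ u, f (x + δ • (u : Vec d)) • (u : Vec d) ∂(sphereUniform d)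

/-- No divergence theorem is needed. The error `e` is tested against its own direction `w`, and the
integral is antisymmetrized under the reflection `R` that sends `w` to `-w`. The points `x + δu` and
`x + δRu` differ by `2δ⟨u,w⟩w`, and on the ball of radius `δ` the gradient stays within `Lg δ` of
its value at `x`. The mean value inequality thus bounds the integrand by `2 Lg δ² ⟨u,w⟩²`. Its mean
contains a factor `1/d`, which cancels the `d` of the estimator. -/
theorem norm_smoothedGrad_sub_gradient_le [NeZero d] {f : Vec d → ℝ} {Lg δ : ℝ} (hδ : 0 < δ)
    (hf : Differentiable ℝ f) (hLg : ∀ x y, ‖∇ f x - ∇ f y‖ ≤ Lg * ‖x - y‖) (x : Vec d) :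
    ‖smoothedGrad δ f x - ∇ f x‖ ≤ Lg * δ := by
  have hd : (0 : ℝ) < d := by exact_mod_cast Nat.pos_of_ne_zero (NeZero.ne d)
  have hfc : Continuous f := hf.continuous
  obtain h0 | h0 := eq_or_ne (smoothedGrad δ f x - ∇ f x) 0
  · have := (norm_nonneg _).trans (hLg (EuclideanSpace.single 0 1) 0)
    have : 0 ≤ Lg := by simpa using this
    rw [h0, norm_zero]; positivity
  set e := smoothedGrad δ f x - ∇ f x with he
  have he0 : 0 < ‖e‖ := norm_pos_iff.mpr h0
  set w : Vec d := ‖e‖⁻¹ • e with hw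
  have hw1 : ‖w‖ = 1 := by rw [hw, norm_smul, norm_inv, norm_norm, inv_mul_cancel₀ he0.ne']
  have hew : inner ℝ e w = ‖e‖ := by
    rw [hw, real_inner_smul_right, real_inner_self_eq_norm_sq]; field_simp
  let R := (ℝ ∙ w)ᗮ.reflection
  have hRw : R w = -w := Submodule.reflection_orthogonalComplement_singleton_eq_neg w
  have hR : ∀ u, R u = u - (2 * inner ℝ u w) • w := fun u => by
    have : R u = - (ℝ ∙ w).reflection u := Submodule.reflection_orthogonal_apply _ u
    rw [this, Submodule.reflection_singleton_apply, hw1, real_inner_comm]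
    simp [two_smul, two_mul, add_smul]
  set I := ∫ u, f (x + δ • (u : Vec d)) * inner ℝ (u : Vec d) w ∂(sphereUniform d) with hI
  have hI2 : I = -∫ u, f (x + δ • R u) * inner ℝ (u : Vec d) w ∂(sphereUniform d) := by
    rw [hI, ← integral_sphereUniform_isometry R fun u => f (x + δ • u) * inner ℝ u w,
      ← integral_neg]
    refine integral_congr_ae (.of_forall fun u => ?_)
    have : inner ℝ (R u) w = - inner ℝ (u : Vec d) w := by
      have := R.inner_map_map (u : Vec d) w
      rw [hRw, inner_neg_right] at this
      linarith
    simp [this]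
  have hRc : Continuous R := R.continuous
  have hsum : 2 * I - 2 * δ * inner ℝ (∇ f x) w * (1 / d) =
      ∫ u, (f (x + δ • (u : Vec d)) - f (x + δ • R u) - inner ℝ (∇ f x) w *
        (2 * δ * inner ℝ (u : Vec d) w)) * inner ℝ (u : Vec d) w ∂(sphereUniform d) := by
    have e1 : 2 * I = I - ∫ u, f (x + δ • R u) * inner ℝ (u : Vec d) w ∂(sphereUniform d) := by
      linarith
    rw [e1, ← integral_sphereUniform_inner_sq hw1, ← integral_const_mul, hI, ← integral_sub,
      ← integral_sub]
    · refine integral_congr_ae (.of_forall fun u => ?_)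
      simp only
      ring
    · exact integrable_sphereUniform (φ := fun u => f (x + δ • u) * inner ℝ u w
        - f (x + δ • R u) * inner ℝ u w) (by fun_prop)
    · exact integrable_sphereUniform (φ := fun u => 2 * δ * inner ℝ (∇ f x) w * inner ℝ u w ^ 2)
        (by fun_prop)
    · exact integrable_sphereUniform (φ := fun u => f (x + δ • u) * inner ℝ u w) (by fun_prop)
    · exact integrable_sphereUniform (φ := fun u => f (x + δ • R u) * inner ℝ u w) (by fun_prop)
  have hbd : |2 * I - 2 * δ * inner ℝ (∇ f x) w * (1 / d)| ≤ 2 * Lg * δ ^ 2 * (1 / d) := by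
    rw [hsum, ← integral_sphereUniform_inner_sq hw1, ← integral_const_mul, ← Real.norm_eq_abs]
    refine norm_integral_le_of_norm_le (integrable_sphereUniform
      (φ := fun u => 2 * Lg * δ ^ 2 * inner ℝ u w ^ 2) (by fun_prop)) (.of_forall fun u => ?_)
    have hu : ‖(u : Vec d)‖ = 1 := by simp
    have key := Convex.norm_image_sub_le_of_norm_fderiv_le' (𝕜 := ℝ) (f := f)
      (φ := innerSL ℝ (∇ f x)) (C := Lg * δ) (s := Metric.closedBall x δ)
      (x := x + δ • R u) (y := x + δ • (u : Vec d)) (fun z _ => hf z) (fun z hz => ?_)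
      (convex_closedBall _ _) (by simp [norm_smul, hu, abs_of_pos hδ])
      (by simp [norm_smul, hu, abs_of_pos hδ])
    · have e2 : x + δ • (u : Vec d) - (x + δ • R u) = (2 * δ * inner ℝ (u : Vec d) w) • w := by
        rw [hR, smul_sub, smul_smul]
        ring_nf
        abel_nf
      rw [e2, norm_smul, hw1, mul_one, innerSL_apply_apply, real_inner_smul_right] at key
      simp only [Real.norm_eq_abs, abs_mul, abs_of_pos hδ, abs_two] at key ⊢
      rw [mul_comm (inner ℝ (∇ f x) w)]
      calc _ ≤ Lg * δ * (2 * δ * |inner ℝ (u : Vec d) w|) * |inner ℝ (u : Vec d) w| := by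
            gcongr
        _ = 2 * Lg * δ ^ 2 * |inner ℝ (u : Vec d) w| ^ 2 := by ring
        _ = _ := by rw [sq_abs]
    · have hz' : ‖z - x‖ ≤ δ := by simpa [dist_eq_norm] using hz
      have hLg0 : 0 ≤ Lg := by
        have := (norm_nonneg _).trans (hLg (EuclideanSpace.single 0 1) 0)
        simpa using this
      have e3 : fderiv ℝ f z - innerSL ℝ (∇ f x) = innerSL ℝ (∇ f z - ∇ f x) := by
        ext v
        simp [gradient, InnerProductSpace.toDual_symm_apply]
      rw [e3, innerSL_apply_norm]
      exact (hLg z x).trans (by gcongr)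
  have hen : ‖e‖ = (d / δ) * I - inner ℝ (∇ f x) w := by
    rw [← hew, he, inner_sub_left, smoothedGrad, real_inner_smul_left, real_inner_comm,
      ← integral_inner (integrable_sphereUniform (φ := fun u => f (x + δ • u) • u) (by fun_prop))]
    simp only [real_inner_smul_right, hI, real_inner_comm w]
  have e4 : ‖e‖ = (d / (2 * δ)) * (2 * I - 2 * δ * inner ℝ (∇ f x) w * (1 / d)) := by
    rw [hen]; field_simp
  rw [e4]
  calc _ ≤ (d / (2 * δ)) * (2 * Lg * δ ^ 2 * (1 / d)) := by
        gcongr; exact (le_abs_self _).trans hbd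
    _ = Lg * δ := by field_simp

end Sphere

/-! ### Moments of the oracle values within one round. -/

section Oracle

variable {d : ℕ} {S : Type*} [MeasurableSpace S]

/-- The assumptions on the problem that are used round by round. -/
structure Problem.Regular (P : Problem d S) (σ L Lg : ℝ) : Prop where
  var : P.OracleVarianceLE σ
  lip : ∀ x y, |P.objective x - P.objective y| ≤ L * ‖x - y‖
  diff : Differentiable ℝ P.objective
  gradLip : ∀ x y, ‖∇ P.objective x - ∇ P.objective y‖ ≤ Lg * ‖x - y‖

namespace Problem.Regular

variable {P : Problem d S} {σ L Lg : ℝ}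

theorem continuous_objective (h : P.Regular σ L Lg) : Continuous P.objective :=
  h.diff.continuous

theorem L_nonneg [NeZero d] (h : P.Regular σ L Lg) : 0 ≤ L := by
  have := (abs_nonneg _).trans (h.lip (EuclideanSpace.single 0 1) 0)
  simpa using this

theorem Lg_nonneg [NeZero d] (h : P.Regular σ L Lg) : 0 ≤ Lg := by
  have := (norm_nonneg _).trans (h.gradLip (EuclideanSpace.single 0 1) 0)
  simpa using this

theorem continuous_gradient (h : P.Regular σ L Lg) : Continuous (∇ P.objective) :=
  (LipschitzWith.of_dist_le' (K := Lg) fun x y => by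
    simpa [dist_eq_norm] using h.gradLip x y).continuous

theorem norm_gradient_le [NeZero d] (h : P.Regular σ L Lg) (x : Vec d) :
    ‖∇ P.objective x‖ ≤ L := by
  rw [gradient, LinearIsometryEquiv.norm_map]
  have hl : LipschitzWith ⟨L, h.L_nonneg⟩ P.objective := LipschitzWith.of_dist_le_mul fun x y => by
    rw [dist_eq_norm, dist_eq_norm]
    exact h.lip x y
  exact norm_fderiv_le_of_lipschitz ℝ hl

theorem continuous_smoothedGrad [NeZero d] (h : P.Regular σ L Lg) (δ : ℝ) :
    Continuous (smoothedGrad δ P.objective) := by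
  have hc := h.continuous_objective
  have : CompactSpace (Metric.sphere (0 : Vec d) 1) :=
    isCompact_iff_compactSpace.mp (isCompact_sphere _ _)
  unfold smoothedGrad
  have h2 := continuous_parametric_integral_of_continuous (μ := sphereUniform d)
    (f := fun (x : Vec d) (u : Metric.sphere (0 : Vec d) 1) =>
      P.objective (x + δ • (u : Vec d)) • (u : Vec d)) (by fun_prop) isCompact_univ
  simp only [Measure.restrict_univ] at h2
  exact h2.const_smul ((d : ℝ) / δ)

theorem norm_smoothedGrad_le [NeZero d] (h : P.Regular σ L Lg) {δ : ℝ} (hδ : 0 < δ) (x : Vec d) :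
    ‖smoothedGrad δ P.objective x‖ ≤ L + Lg * δ := by
  have h1 := norm_smoothedGrad_sub_gradient_le hδ h.diff h.gradLip x
  have h2 := h.norm_gradient_le x
  have h3 := norm_sub_norm_le (smoothedGrad δ P.objective x) (∇ P.objective x)
  linarith

/-- In `ℝ≥0∞` form the bound can be integrated over random decisions before any integrability is
known. -/
theorem lintegral_query_sub_sq_le (h : P.Regular σ L Lg) (x : Vec d) :
    ∫⁻ v, ENNReal.ofReal ((v - P.objective x) ^ 2) ∂(P.query x) ≤ ENNReal.ofReal (σ ^ 2) := by
  have hF : Measurable (P.F x) := P.measurable_F.comp measurable_prodMk_left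
  obtain ⟨hm, hv⟩ := h.var x
  rw [P.query_apply, lintegral_map (by fun_prop) hF]
  have hi : Integrable (fun ξ => (P.F x ξ - P.objective x) ^ 2) (P.Ξ x) :=
    (hm.sub (memLp_const _)).integrable_sq
  rw [← ofReal_integral_eq_lintegral_ofReal hi (.of_forall fun _ => sq_nonneg _)]
  simp only [sq_abs] at hv
  exact ENNReal.ofReal_le_ofReal hv

theorem integral_query (h : P.Regular σ L Lg) (x : Vec d) :
    Integrable (fun v => v) (P.query x) ∧ ∫ v, v ∂(P.query x) = P.objective x := by
  have hF : Measurable (P.F x) := P.measurable_F.comp measurable_prodMk_left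
  rw [P.query_apply]
  constructor
  · rw [integrable_map_measure (by fun_prop) hF.aemeasurable]
    exact ((h.var x).1.integrable one_le_two)
  · rw [integral_map hF.aemeasurable (by fun_prop)]
    rfl

end Problem.Regular

section Round

variable (P : Problem d S) (opt : Feedback) (δ : ℝ) (M : ℕ) (η : ℝ) (t : ℕ)

/-- The decision of the `i`-th query of round `t + 1`. -/
def decision (z : State d) (i : Fin opt.roundQueries)
    (p : ℝ × Metric.sphere (0 : Vec d) 1) : Vec d :=
  queryPoint δ (evalPoint M t z p.1) p.2 opt i

/-- The joint law of the interpolation parameter, the direction and the oracle values of round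
`t + 1`, given the state after round `t`. -/
def roundNoise (z : State d) :
    Measure ((ℝ × Metric.sphere (0 : Vec d) 1) × (Fin opt.roundQueries → ℝ)) :=
  (Kernel.const (State d) (unitUniform.prod (sphereUniform d)) ⊗ₖ roundValues P opt δ M t) z

theorem measurable_update_noise (z : State d) :
    Measurable fun q : (ℝ × Metric.sphere (0 : Vec d) 1) × (Fin opt.roundQueries → ℝ) =>
      update opt δ M η t z q.1.1 q.1.2 q.2 :=
  (measurable_update opt δ M η t).comp measurable_prodMk_left

theorem roundKernel_apply (z : State d) :
    roundKernel P opt δ M η t z =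
      (roundNoise P opt δ M t z).map fun q => update opt δ M η t z q.1.1 q.1.2 q.2 := by
  rw [roundKernel, Kernel.map_apply _ (measurable_update opt δ M η t), Kernel.prod_apply,
    Kernel.id_apply, Measure.dirac_prod,
    Measure.map_map (measurable_update opt δ M η t) measurable_prodMk_left]
  rfl

@[fun_prop]
theorem measurable_decision (z : State d) (i : Fin opt.roundQueries) :
    Measurable (decision opt δ M t z i) := by
  change Measurable ((fun p : State d × ℝ × Metric.sphere (0 : Vec d) 1 =>
    queryPoint δ (evalPoint M t p.1 p.2.1) p.2.2 opt i) ∘ Prod.mk z)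
  exact (measurable_queryPoint opt δ M t i).comp measurable_prodMk_left

@[fun_prop]
theorem measurable_evalPoint (z : State d) : Measurable (evalPoint M t z) := by
  unfold evalPoint; fun_prop

theorem map_roundValues (z : State d) (p : ℝ × Metric.sphere (0 : Vec d) 1)
    (i : Fin opt.roundQueries) :
    (roundValues P opt δ M t (z, p)).map (fun v => v i)
      = P.query (decision opt δ M t z i p) := by
  have h := measurePreserving_eval (μ := fun i =>
    P.query.comap _ (measurable_queryPoint opt δ M t i) (z, p)) i
  exact h.map_eq

theorem norm_decision_sub {δ : ℝ} (hδ : 0 < δ) (z : State d) (i : Fin opt.roundQueries)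
    (p : ℝ × Metric.sphere (0 : Vec d) 1) :
    ‖decision opt δ M t z i p - evalPoint M t z p.1‖ = δ := by
  have hu : ‖(p.2 : Vec d)‖ = 1 := by simp
  cases opt
  · fin_cases i <;> simp [decision, queryPoint, norm_smul, hu, abs_of_pos hδ]
  · fin_cases i; simp [decision, queryPoint, norm_smul, hu, abs_of_pos hδ]

theorem integral_value {σ L Lg : ℝ} (hP : P.Regular σ L Lg) (z : State d)
    (p : ℝ × Metric.sphere (0 : Vec d) 1) (i : Fin opt.roundQueries) :
    Integrable (fun v => v i) (roundValues P opt δ M t (z, p)) ∧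
    ∫ v, v i ∂(roundValues P opt δ M t (z, p)) = P.objective (decision opt δ M t z i p) := by
  have h := hP.integral_query (decision opt δ M t z i p)
  rw [← map_roundValues] at h
  have hm : Measurable fun v : Fin opt.roundQueries → ℝ => v i := by fun_prop
  rw [integrable_map_measure (by fun_prop) hm.aemeasurable,
    integral_map hm.aemeasurable (by fun_prop)] at h
  exact h

variable [NeZero d]

instance (z : State d) : IsProbabilityMeasure (roundNoise P opt δ M t z) := by
  unfold roundNoise; infer_instance

theorem lintegral_roundNoise {φ : (ℝ × Metric.sphere (0 : Vec d) 1) × (Fin opt.roundQueries → ℝ) →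
    ENNReal} (hφ : Measurable φ) (z : State d) :
    ∫⁻ q, φ q ∂(roundNoise P opt δ M t z) = ∫⁻ p, ∫⁻ v, φ (p, v)
      ∂(roundValues P opt δ M t (z, p)) ∂(unitUniform.prod (sphereUniform d)) := by
  rw [roundNoise, Kernel.lintegral_compProd _ _ _ hφ]
  rfl

theorem integral_roundNoise {φ : (ℝ × Metric.sphere (0 : Vec d) 1) × (Fin opt.roundQueries → ℝ) →
    ℝ} {z : State d} (hφ : Integrable φ (roundNoise P opt δ M t z)) :
    Integrable (fun p => ∫ v, φ (p, v) ∂(roundValues P opt δ M t (z, p)))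
      (unitUniform.prod (sphereUniform d)) ∧
    ∫ q, φ q ∂(roundNoise P opt δ M t z) = ∫ p, ∫ v, φ (p, v)
      ∂(roundValues P opt δ M t (z, p)) ∂(unitUniform.prod (sphereUniform d)) := by
  rw [roundNoise] at *
  exact ⟨hφ.integral_compProd, ProbabilityTheory.integral_compProd hφ⟩

theorem map_fst_roundNoise (z : State d) :
    (roundNoise P opt δ M t z).map Prod.fst = unitUniform.prod (sphereUniform d) := by
  ext s hs
  rw [Measure.map_apply measurable_fst hs, ← lintegral_indicator_one (measurable_fst hs),
    lintegral_roundNoise _ _ _ _ _ (measurable_one.indicator (measurable_fst hs)),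
    ← lintegral_indicator_one hs]
  refine lintegral_congr fun p => ?_
  by_cases hp : p ∈ s <;> simp [Set.indicator, hp]

theorem ae_roundNoise_mem_Icc (z : State d) :
    ∀ᵐ q ∂(roundNoise P opt δ M t z), q.1.1 ∈ Set.Icc (0 : ℝ) 1 := by
  have h1 : ∀ᵐ s ∂unitUniform, s ∈ Set.Icc (0 : ℝ) 1 := ae_restrict_mem measurableSet_Icc
  have h2 := (measurePreserving_fst (μ := unitUniform)
    (ν := sphereUniform d)).quasiMeasurePreserving.ae h1
  rw [← map_fst_roundNoise P opt δ M t z] at h2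
  exact ae_of_ae_map measurable_fst.aemeasurable h2

variable {P opt δ M η t} {σ L Lg : ℝ}

theorem memLp_two_of_lintegral_sq_le {α : Type*} [MeasurableSpace α] {μ : Measure α} {X : α → ℝ}
    {b : ℝ} (hX : Measurable X) (h : ∫⁻ a, ENNReal.ofReal (X a ^ 2) ∂μ ≤ ENNReal.ofReal b)
    (hb : 0 ≤ b) : MemLp X 2 μ ∧ ∫ a, X a ^ 2 ∂μ ≤ b := by
  have hi : Integrable (fun a => X a ^ 2) μ := by
    refine ⟨by fun_prop, ?_⟩
    rw [hasFiniteIntegral_iff_ofReal (.of_forall fun _ => sq_nonneg _)]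
    exact h.trans_lt ENNReal.ofReal_lt_top
  refine ⟨(memLp_two_iff_integrable_sq hX.aestronglyMeasurable).mpr hi, ?_⟩
  rw [integral_eq_lintegral_of_nonneg_ae (.of_forall fun _ => sq_nonneg _) hi.1]
  exact ENNReal.toReal_le_of_le_ofReal hb h

theorem memLp_value_sub (hP : P.Regular σ L Lg) (z : State d) (i : Fin opt.roundQueries) :
    MemLp (fun q => q.2 i - P.objective (decision opt δ M t z i q.1)) 2
      (roundNoise P opt δ M t z) ∧
    ∫ q, (q.2 i - P.objective (decision opt δ M t z i q.1)) ^ 2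
      ∂(roundNoise P opt δ M t z) ≤ σ ^ 2 := by
  have hq := measurable_decision opt δ M t z i
  have hc := hP.continuous_objective.measurable
  have hX : Measurable fun q : (ℝ × Metric.sphere (0 : Vec d) 1) × (Fin opt.roundQueries → ℝ) =>
    q.2 i - P.objective (decision opt δ M t z i q.1) := by fun_prop
  refine memLp_two_of_lintegral_sq_le hX ?_ (sq_nonneg σ)
  rw [lintegral_roundNoise _ _ _ _ _ (by fun_prop)]
  calc _ ≤ ∫⁻ p, ENNReal.ofReal (σ ^ 2) ∂(unitUniform.prod (sphereUniform d)) := by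
        refine lintegral_mono fun p => ?_
        have := hP.lintegral_query_sub_sq_le (decision opt δ M t z i p)
        rwa [← map_roundValues, lintegral_map (by fun_prop) (by fun_prop)] at this
    _ = _ := by simp

/-- Queries are made at distance `δ` from the evaluation point, which shifts the mean by at most `L
δ`; the factor 2 comes from `(a + b)² ≤ 2a² + 2b²`. -/
theorem memLp_value_sub_evalPoint (hP : P.Regular σ L Lg) (hδ : 0 < δ) (z : State d)
    (i : Fin opt.roundQueries) :
    MemLp (fun q => q.2 i - P.objective (evalPoint M t z q.1.1)) 2
      (roundNoise P opt δ M t z) ∧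
    ∫ q, (q.2 i - P.objective (evalPoint M t z q.1.1)) ^ 2
      ∂(roundNoise P opt δ M t z) ≤ 2 * (σ ^ 2 + L ^ 2 * δ ^ 2) := by
  have hq := measurable_decision opt δ M t z i
  have hc := hP.continuous_objective.measurable
  obtain ⟨h1, h2⟩ := memLp_value_sub (t := t) (M := M) (δ := δ) (opt := opt) hP z i
  have hb : ∀ q : (ℝ × Metric.sphere (0 : Vec d) 1) × (Fin opt.roundQueries → ℝ),
      |P.objective (decision opt δ M t z i q.1) - P.objective (evalPoint M t z q.1.1)|
        ≤ L * δ := fun q => by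
    have := hP.lip (decision opt δ M t z i q.1) (evalPoint M t z q.1.1)
    rwa [norm_decision_sub _ _ _ hδ] at this
  have h3 : MemLp (fun q : (ℝ × Metric.sphere (0 : Vec d) 1) × (Fin opt.roundQueries → ℝ) =>
      P.objective (decision opt δ M t z i q.1) - P.objective (evalPoint M t z q.1.1)) 2
      (roundNoise P opt δ M t z) :=
    MemLp.of_bound (by fun_prop) (L * δ) (.of_forall hb)
  have h4 : MemLp (fun q => q.2 i - P.objective (evalPoint M t z q.1.1)) 2
      (roundNoise P opt δ M t z) := by
    convert h1.add h3 using 1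
    ext q
    simp
  refine ⟨h4, ?_⟩
  calc _ ≤ ∫ q, (2 * (q.2 i - P.objective (decision opt δ M t z i q.1)) ^ 2
        + 2 * (L * δ) ^ 2) ∂(roundNoise P opt δ M t z) := by
        refine integral_mono h4.integrable_sq
          ((h1.integrable_sq.const_mul _).add (integrable_const _)) fun q => ?_
        have := sq_le_sq' (by linarith [(abs_le.mp (hb q)).1]) (abs_le.mp (hb q)).2
        simp only
        nlinarith [sq_nonneg ((q.2 i - P.objective (decision opt δ M t z i q.1)) -
          (P.objective (decision opt δ M t z i q.1) - P.objective (evalPoint M t z q.1.1)))]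
    _ ≤ _ := by
        rw [integral_add (h1.integrable_sq.const_mul _) (integrable_const _),
          integral_const_mul]
        simp
        nlinarith

end Round

end Oracle

/-! ### One round of the algorithm from a fixed state: second moment, unbiasedness and descent. -/

section RoundKernel

variable {d : ℕ} {S : Type*} [MeasurableSpace S]

/-- The relations between consecutive states that hold almost surely. -/
structure IsRound (r η : ℝ) (M t : ℕ) (z z' : State d) : Prop where
  x_eq : z'.x = z.x + increment M t z
  Δ_eq : z'.Δ = ballProj r (increment M t z - η • z'.g)
  y_sub_left : ‖z'.y - z.x‖ ≤ ‖increment M t z‖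
  y_sub_right : ‖z'.y - z'.x‖ ≤ ‖increment M t z‖

theorem measurableSet_isRound (r η : ℝ) (M t : ℕ) :
    MeasurableSet {p : State d × State d | IsRound r η M t p.1 p.2} := by
  have h : {p : State d × State d | IsRound r η M t p.1 p.2} =
      {p | p.2.x = p.1.x + increment M t p.1} ∩
      {p | p.2.Δ = ballProj r (increment M t p.1 - η • p.2.g)} ∩
      {p | ‖p.2.y - p.1.x‖ ≤ ‖increment M t p.1‖} ∩
      {p | ‖p.2.y - p.2.x‖ ≤ ‖increment M t p.1‖} := by
    ext p
    exact ⟨fun h => ⟨⟨⟨h.1, h.2⟩, h.3⟩, h.4⟩, fun h => ⟨h.1.1.1, h.1.1.2, h.1.2, h.2⟩⟩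
  rw [h]
  refine (((measurableSet_eq_fun (by fun_prop) (by fun_prop)).inter
    (measurableSet_eq_fun (by fun_prop) (by fun_prop))).inter
    (measurableSet_le (by fun_prop) (by fun_prop))).inter
    (measurableSet_le (by fun_prop) (by fun_prop))

/-- The error of the stored oracle value, as used in the next round. -/
def residual (P : Problem d S) : Feedback → State d → ℝ
  | .twoPoint, _ => 0
  | .onePoint, z => z.h - P.objective z.y

variable {P : Problem d S} {opt : Feedback} {δ : ℝ} {M : ℕ} {η : ℝ} {t : ℕ} {σ L Lg : ℝ}

theorem measurable_residual (hP : P.Regular σ L Lg) : Measurable (residual P opt) := by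
  have := hP.continuous_objective.measurable
  cases opt
  · exact measurable_const
  · change Measurable fun z : State d => z.h - P.objective z.y
    fun_prop

theorem norm_evalPoint_sub_le (z : State d) {s : ℝ} (hs : s ∈ Set.Icc (0 : ℝ) 1) :
    ‖evalPoint M t z s - z.x‖ ≤ ‖increment M t z‖ ∧
    ‖evalPoint M t z s - (z.x + increment M t z)‖ ≤ ‖increment M t z‖ := by
  have e1 : evalPoint M t z s - z.x = s • increment M t z := by simp [evalPoint]
  have e2 : evalPoint M t z s - (z.x + increment M t z) = (s - 1) • increment M t z := by
    rw [evalPoint, sub_smul, one_smul]; abel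
  rw [e1, e2, norm_smul, norm_smul]
  constructor
  · refine mul_le_of_le_one_left (norm_nonneg _) ?_
    rw [Real.norm_eq_abs, abs_le]; exact ⟨by linarith [hs.1], hs.2⟩
  · refine mul_le_of_le_one_left (norm_nonneg _) ?_
    rw [Real.norm_eq_abs, abs_le]; exact ⟨by linarith [hs.1], by linarith [hs.2]⟩

theorem integrable_roundKernel_iff {ψ : State d → ℝ} (hψ : Measurable ψ) (z : State d) :
    Integrable ψ (roundKernel P opt δ M η t z) ↔
      Integrable (fun q => ψ (update opt δ M η t z q.1.1 q.1.2 q.2))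
        (roundNoise P opt δ M t z) := by
  rw [roundKernel_apply, integrable_map_measure hψ.aestronglyMeasurable
    (measurable_update_noise _ _ _ _ _ _).aemeasurable]
  rfl

theorem integral_roundKernel {ψ : State d → ℝ} (hψ : Measurable ψ) (z : State d) :
    ∫ z', ψ z' ∂(roundKernel P opt δ M η t z) =
      ∫ q, ψ (update opt δ M η t z q.1.1 q.1.2 q.2) ∂(roundNoise P opt δ M t z) := by
  rw [roundKernel_apply, integral_map (measurable_update_noise _ _ _ _ _ _).aemeasurable
    hψ.aestronglyMeasurable]

variable [NeZero d]

theorem ae_isRound (z : State d) :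
    ∀ᵐ z' ∂(roundKernel P opt δ M η t z), IsRound (δ / M) η M t z z' := by
  have hm : MeasurableSet {z' : State d | IsRound (δ / M) η M t z z'} :=
    measurable_prodMk_left (measurableSet_isRound (δ / M) η M t)
  rw [roundKernel_apply, ae_map_iff (measurable_update_noise _ _ _ _ _ _).aemeasurable hm]
  filter_upwards [ae_roundNoise_mem_Icc P opt δ M t z] with q hq
  obtain ⟨h1, h2⟩ := norm_evalPoint_sub_le (M := M) (t := t) z hq
  exact ⟨rfl, rfl, h1, h2⟩

theorem integral_residual_sq_le (hP : P.Regular σ L Lg) (hδ : 0 < δ) (z : State d) :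
    Integrable (fun z' => residual P opt z' ^ 2) (roundKernel P opt δ M η t z) ∧
    ∫ z', residual P opt z' ^ 2 ∂(roundKernel P opt δ M η t z)
      ≤ 2 * (σ ^ 2 + L ^ 2 * δ ^ 2) := by
  have hm : Measurable fun z' => residual P opt z' ^ 2 := (measurable_residual hP).pow_const 2
  rw [integrable_roundKernel_iff hm, integral_roundKernel hm]
  cases opt
  · simp [residual]; positivity
  · have h := memLp_value_sub_evalPoint (opt := .onePoint) (M := M) (t := t) hP hδ z 0
    exact ⟨h.1.integrable_sq, h.2⟩

/-- With two points the common value `f(y_t)` cancels, leaving two centred errors. With one point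
the difference of values is a new error, plus a change of the objective of size at most `L r`, minus
the stored `residual`, whence the factors 3. The stated bound covers both. -/
theorem integral_norm_g_sq_le (hP : P.Regular σ L Lg) (hδ : 0 < δ) (z : State d) {r : ℝ}
    (hr : ∀ s ∈ Set.Icc (0 : ℝ) 1, ‖evalPoint M t z s - z.y‖ ≤ r) :
    Integrable (fun z' => ‖z'.g‖ ^ 2) (roundKernel P opt δ M η t z) ∧
    ∫ z', ‖z'.g‖ ^ 2 ∂(roundKernel P opt δ M η t z)
      ≤ (d / δ) ^ 2 * (6 * (σ ^ 2 + L ^ 2 * δ ^ 2) + 3 * L ^ 2 * r ^ 2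
        + 3 * residual P opt z ^ 2) := by
  have hm : Measurable fun z' : State d => ‖z'.g‖ ^ 2 := by fun_prop
  have hc := hP.continuous_objective.measurable
  have hr0 : 0 ≤ r := (norm_nonneg _).trans (hr 0 (by simp))
  rw [integrable_roundKernel_iff hm, integral_roundKernel hm]
  have hprob : IsProbabilityMeasure (roundNoise P opt δ M t z) := inferInstance
  cases opt
  · obtain ⟨h0, h0'⟩ := memLp_value_sub_evalPoint (opt := .twoPoint) (M := M) (t := t) hP hδ z 0
    obtain ⟨h1, h1'⟩ := memLp_value_sub_evalPoint (opt := .twoPoint) (M := M) (t := t) hP hδ z 1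
    have e : (fun q : (ℝ × Metric.sphere (0 : Vec d) 1) ×
        (Fin Feedback.twoPoint.roundQueries → ℝ) =>
        ‖(update .twoPoint δ M η t z q.1.1 q.1.2 q.2).g‖ ^ 2) = fun q => (d / (2 * δ)) ^ 2 *
        ((q.2 0 - P.objective (evalPoint M t z q.1.1))
          - (q.2 1 - P.objective (evalPoint M t z q.1.1))) ^ 2 := by
      ext q
      have hu : ‖(q.1.2 : Vec d)‖ = 1 := by simp
      simp only [update, estimator, State.g, norm_smul, hu, mul_one, Real.norm_eq_abs, sq_abs]
      ring
    rw [e]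
    have hs := h0.sub h1
    refine ⟨hs.integrable_sq.const_mul _, ?_⟩
    calc _ ≤ ∫ q, ((d / (2 * δ)) ^ 2 * (2 * (q.2 0 - P.objective (evalPoint M t z q.1.1)) ^ 2
          + 2 * (q.2 1 - P.objective (evalPoint M t z q.1.1)) ^ 2))
          ∂(roundNoise P .twoPoint δ M t z) := by
          refine integral_mono (hs.integrable_sq.const_mul _)
            (((h0.integrable_sq.const_mul _).add (h1.integrable_sq.const_mul _)).const_mul _)
            fun q => ?_
          simp only
          gcongr
          nlinarith [sq_nonneg ((q.2 0 - P.objective (evalPoint M t z q.1.1))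
            + (q.2 1 - P.objective (evalPoint M t z q.1.1)))]
      _ = (d / δ) ^ 2 * (1 / 4) * (2 * ∫ q, (q.2 0 - P.objective (evalPoint M t z q.1.1)) ^ 2
            ∂(roundNoise P .twoPoint δ M t z)
          + 2 * ∫ q, (q.2 1 - P.objective (evalPoint M t z q.1.1)) ^ 2
            ∂(roundNoise P .twoPoint δ M t z)) := by
          rw [integral_const_mul, integral_add (h0.integrable_sq.const_mul _)
            (h1.integrable_sq.const_mul _), integral_const_mul, integral_const_mul]
          congr 1
          field_simp; norm_num
      _ ≤ _ := by
          rw [mul_assoc]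
          have : 0 ≤ L ^ 2 * r ^ 2 := by positivity
          have : 0 ≤ σ ^ 2 + L ^ 2 * δ ^ 2 := by positivity
          gcongr
          nlinarith [sq_nonneg (residual P .twoPoint z)]
  · obtain ⟨h0, h0'⟩ := memLp_value_sub_evalPoint (opt := .onePoint) (M := M) (t := t) hP hδ z 0
    set c := residual P .onePoint z with hcdef
    have e : (fun q : (ℝ × Metric.sphere (0 : Vec d) 1) ×
        (Fin Feedback.onePoint.roundQueries → ℝ) =>
        ‖(update .onePoint δ M η t z q.1.1 q.1.2 q.2).g‖ ^ 2) = fun q => (d / δ) ^ 2 *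
        ((q.2 0 - P.objective (evalPoint M t z q.1.1))
          + (P.objective (evalPoint M t z q.1.1) - P.objective z.y) - c) ^ 2 := by
      ext q
      have hu : ‖(q.1.2 : Vec d)‖ = 1 := by simp
      simp only [update, estimator, State.g, norm_smul, hu, mul_one, Real.norm_eq_abs, sq_abs,
        hcdef, residual]
      ring
    rw [e]
    have hb : ∀ᵐ q ∂(roundNoise P .onePoint δ M t z),
        ‖P.objective (evalPoint M t z q.1.1) - P.objective z.y‖ ≤ L * r := by
      filter_upwards [ae_roundNoise_mem_Icc P .onePoint δ M t z] with q hq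
      exact (hP.lip _ _).trans (mul_le_mul_of_nonneg_left (hr _ hq) hP.L_nonneg)
    have h1 : MemLp (fun q : (ℝ × Metric.sphere (0 : Vec d) 1) ×
        (Fin Feedback.onePoint.roundQueries → ℝ) =>
        P.objective (evalPoint M t z q.1.1) - P.objective z.y) 2
        (roundNoise P .onePoint δ M t z) := MemLp.of_bound
          (Measurable.aestronglyMeasurable (by fun_prop)) _ hb
    have hs := (h0.add h1).sub (memLp_const c)
    refine ⟨hs.integrable_sq.const_mul _, ?_⟩
    calc _ ≤ ∫ q, ((d / δ) ^ 2 * (3 * (q.2 0 - P.objective (evalPoint M t z q.1.1)) ^ 2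
          + (3 * (L * r) ^ 2 + 3 * c ^ 2))) ∂(roundNoise P .onePoint δ M t z) := by
          refine integral_mono_ae (hs.integrable_sq.const_mul _)
            (((h0.integrable_sq.const_mul _).add (integrable_const _)).const_mul _) ?_
          filter_upwards [hb] with q hq
          have hq2 : (P.objective (evalPoint M t z q.1.1) - P.objective z.y) ^ 2 ≤ (L * r) ^ 2 := by
            rw [← sq_abs]; exact pow_le_pow_left₀ (abs_nonneg _) hq 2
          set a := q.2 0 - P.objective (evalPoint M t z q.1.1)
          set b := P.objective (evalPoint M t z q.1.1) - P.objective z.y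
          gcongr
          nlinarith [sq_nonneg (a - b), sq_nonneg (a + c), sq_nonneg (b + c)]
      _ = (d / δ) ^ 2 * (3 * ∫ q, (q.2 0 - P.objective (evalPoint M t z q.1.1)) ^ 2
            ∂(roundNoise P .onePoint δ M t z) + (3 * (L * r) ^ 2 + 3 * c ^ 2)) := by
          rw [integral_const_mul, integral_add (h0.integrable_sq.const_mul _)
            (integrable_const _), integral_const_mul]
          simp
      _ ≤ _ := by
          refine mul_le_mul_of_nonneg_left ?_ (by positivity)
          rw [mul_pow]
          linarith

theorem integral_objective_mul_inner (hP : P.Regular σ L Lg) (hδ : 0 < δ) (y c : Vec d) :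
    ∫ u, P.objective (y + δ • (u : Vec d)) * inner ℝ (u : Vec d) c ∂(sphereUniform d)
      = δ / d * inner ℝ (smoothedGrad δ P.objective y) c ∧
    ∫ u, P.objective (y - δ • (u : Vec d)) * inner ℝ (u : Vec d) c ∂(sphereUniform d)
      = -(δ / d * inner ℝ (smoothedGrad δ P.objective y) c) := by
  have hd : (d : ℝ) ≠ 0 := by exact_mod_cast NeZero.ne d
  have hc := hP.continuous_objective
  have h1 : ∫ u, P.objective (y + δ • (u : Vec d)) * inner ℝ (u : Vec d) c ∂(sphereUniform d)
      = δ / d * inner ℝ (smoothedGrad δ P.objective y) c := by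
    rw [smoothedGrad, real_inner_smul_left, real_inner_comm, ← integral_inner
      (integrable_sphereUniform (φ := fun u => P.objective (y + δ • u) • u) (by fun_prop)),
      ← mul_assoc]
    simp only [real_inner_smul_right, real_inner_comm c]
    field_simp
  refine ⟨h1, ?_⟩
  rw [← h1, ← integral_sphereUniform_isometry (LinearIsometryEquiv.neg ℝ)
    (fun u : Vec d => P.objective (y + δ • u) * inner ℝ u c), ← integral_neg]
  simp [sub_eq_add_neg]

/-- With `s` fixed, averaging over the oracle replaces values by the objective. In Option I the
antithetic halves contribute equally; in Option II the term with `z.h` vanishes since `u` has mean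
zero. -/
theorem integral_inner_g_sub_smoothedGrad (hP : P.Regular σ L Lg) (hδ : 0 < δ) (z : State d)
    (c : Vec d) :
    ∫ z', inner ℝ (z'.g - smoothedGrad δ P.objective z'.y) c
      ∂(roundKernel P opt δ M η t z) = 0 := by
  have hd : (d : ℝ) ≠ 0 := by exact_mod_cast NeZero.ne d
  have hcont := hP.continuous_objective
  have hG := (hP.continuous_smoothedGrad δ).measurable
  have hm : Measurable fun z' : State d =>
      inner ℝ (z'.g - smoothedGrad δ P.objective z'.y) c := by fun_prop
  have hi : Integrable (fun z' : State d => inner ℝ (z'.g - smoothedGrad δ P.objective z'.y) c)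
      (roundKernel P opt δ M η t z) := by
    have h1 := (integral_norm_g_sq_le (opt := opt) (η := η) hP hδ z
      (r := ‖increment M t z‖ + ‖z.x - z.y‖) fun s hs => by
        have := norm_sub_le_norm_sub_add_norm_sub (evalPoint M t z s) z.x z.y
        linarith [(norm_evalPoint_sub_le (M := M) (t := t) z hs).1]).1
    have h2 : MemLp (fun z' : State d => z'.g) 2 (roundKernel P opt δ M η t z) :=
      (memLp_two_iff_integrable_sq_norm (Measurable.aestronglyMeasurable (by fun_prop))).mpr h1
    have h3 : MemLp (fun z' : State d => smoothedGrad δ P.objective z'.y) 2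
        (roundKernel P opt δ M η t z) :=
      MemLp.of_bound (Measurable.aestronglyMeasurable (by fun_prop)) _
        (.of_forall fun z' => hP.norm_smoothedGrad_le hδ _)
    exact ((h2.sub h3).integrable one_le_two).inner_const c
  rw [integrable_roundKernel_iff hm] at hi
  rw [integral_roundKernel hm]
  obtain ⟨h1, h2⟩ := integral_roundNoise _ _ _ _ _ hi
  rw [h2, integral_prod _ h1]
  refine integral_eq_zero_of_ae (.of_forall fun s => ?_)
  simp only [Pi.zero_apply]
  set y := evalPoint M t z s with hy
  set b := inner ℝ (smoothedGrad δ P.objective y) c with hb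
  obtain ⟨h3, h4⟩ := integral_objective_mul_inner hP hδ y c
  have hz : ∫ u, inner ℝ (u : Vec d) c ∂(sphereUniform d) = 0 := by
    simp_rw [real_inner_comm c]
    rw [integral_inner (integrable_sphereUniform (φ := fun u => u) (by fun_prop)),
      integral_sphereUniform_coe, inner_zero_right]
  have i1 : Integrable (fun u : Metric.sphere (0 : Vec d) 1 =>
      P.objective (y + δ • (u : Vec d)) * inner ℝ (u : Vec d) c) (sphereUniform d) :=
    integrable_sphereUniform (φ := fun u => P.objective (y + δ • u) * inner ℝ u c) (by fun_prop)
  have i2 : Integrable (fun u : Metric.sphere (0 : Vec d) 1 =>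
      P.objective (y - δ • (u : Vec d)) * inner ℝ (u : Vec d) c) (sphereUniform d) :=
    integrable_sphereUniform (φ := fun u => P.objective (y - δ • u) * inner ℝ u c) (by fun_prop)
  have i3 : Integrable (fun u : Metric.sphere (0 : Vec d) 1 => inner ℝ (u : Vec d) c)
      (sphereUniform d) := integrable_sphereUniform (φ := fun u => inner ℝ u c) (by fun_prop)
  have hprob : ∀ p, IsProbabilityMeasure (roundValues P opt δ M t (z, p)) :=
    fun p => inferInstance
  cases opt
  · have key : ∀ u : Metric.sphere (0 : Vec d) 1,
        ∫ v, inner ℝ ((update .twoPoint δ M η t z s u v).g -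
          smoothedGrad δ P.objective (update .twoPoint δ M η t z s u v).y) c
          ∂(roundValues P .twoPoint δ M t (z, s, u)) =
        d / (2 * δ) * (P.objective (y + δ • (u : Vec d)) * inner ℝ (u : Vec d) c
          - P.objective (y - δ • (u : Vec d)) * inner ℝ (u : Vec d) c) - b := fun u => by
      obtain ⟨j0, k0⟩ := integral_value P .twoPoint δ M t hP z (s, u) 0
      obtain ⟨j1, k1⟩ := integral_value P .twoPoint δ M t hP z (s, u) 1
      simp only [update, estimator, State.g, State.y, inner_sub_left, real_inner_smul_left,
        ← hy, ← hb]
      have j2 : Integrable (fun v : Fin Feedback.twoPoint.roundQueries → ℝ =>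
          (d : ℝ) / (2 * δ) * (v 0 - v 1) * inner ℝ (u : Vec d) c)
          (roundValues P .twoPoint δ M t (z, s, u)) := ((j0.sub j1).const_mul _).mul_const _
      rw [integral_sub j2 (integrable_const _), integral_mul_const, integral_const_mul,
        integral_sub j0 j1, k0, k1]
      simp [decision, queryPoint, ← hy]
      ring
    simp_rw [key]
    have i4 : Integrable (fun u : Metric.sphere (0 : Vec d) 1 => (d : ℝ) / (2 * δ) *
        (P.objective (y + δ • (u : Vec d)) * inner ℝ (u : Vec d) c
          - P.objective (y - δ • (u : Vec d)) * inner ℝ (u : Vec d) c)) (sphereUniform d) :=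
      (i1.sub i2).const_mul _
    rw [integral_sub i4 (integrable_const _), integral_const_mul,
      integral_sub i1 i2, h3, h4]
    simp
    field_simp
    ring
  · have key : ∀ u : Metric.sphere (0 : Vec d) 1,
        ∫ v, inner ℝ ((update .onePoint δ M η t z s u v).g -
          smoothedGrad δ P.objective (update .onePoint δ M η t z s u v).y) c
          ∂(roundValues P .onePoint δ M t (z, s, u)) =
        d / δ * (P.objective (y + δ • (u : Vec d)) * inner ℝ (u : Vec d) c
          - z.h * inner ℝ (u : Vec d) c) - b := fun u => by
      obtain ⟨j0, k0⟩ := integral_value P .onePoint δ M t hP z (s, u) 0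
      simp only [update, estimator, State.g, State.y, inner_sub_left, real_inner_smul_left,
        ← hy, ← hb]
      have j2 : Integrable (fun v : Fin Feedback.onePoint.roundQueries → ℝ =>
          (d : ℝ) / δ * (v 0 - z.h) * inner ℝ (u : Vec d) c)
          (roundValues P .onePoint δ M t (z, s, u)) :=
        ((j0.sub (integrable_const _)).const_mul _).mul_const _
      rw [integral_sub j2 (integrable_const _), integral_mul_const, integral_const_mul,
        integral_sub j0 (integrable_const _), k0]
      simp [decision, queryPoint, ← hy]
      ring
    simp_rw [key]
    have i4 : Integrable (fun u : Metric.sphere (0 : Vec d) 1 => (d : ℝ) / δ *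
        (P.objective (y + δ • (u : Vec d)) * inner ℝ (u : Vec d) c
          - z.h * inner ℝ (u : Vec d) c)) (sphereUniform d) :=
      (i1.sub (i3.const_mul _)).const_mul _
    rw [integral_sub i4 (integrable_const _),
      integral_const_mul, integral_sub i1 (i3.const_mul _), integral_const_mul, h3, hz]
    simp
    field_simp
    ring

/-- A uniform point on the segment turns the mean directional derivative into the integral of the
derivative along it. The fundamental theorem of calculus gives an identity, with no smoothness
error. -/
theorem integral_inner_gradient_increment (hP : P.Regular σ L Lg) (z : State d) :
    ∫ z', inner ℝ (∇ P.objective z'.y) (increment M t z) ∂(roundKernel P opt δ M η t z)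
      = P.objective (z.x + increment M t z) - P.objective z.x := by
  have hc := hP.continuous_gradient
  have hcm := hc.measurable
  have hm : Measurable fun z' : State d => inner ℝ (∇ P.objective z'.y) (increment M t z) := by
    fun_prop
  rw [integral_roundKernel hm]
  set w := increment M t z with hw
  have hφ : Measurable fun p : ℝ × Metric.sphere (0 : Vec d) 1 =>
      inner ℝ (∇ P.objective (z.x + p.1 • w)) w := by fun_prop
  calc _ = ∫ q, inner ℝ (∇ P.objective (z.x + q.1.1 • w)) w ∂(roundNoise P opt δ M t z) := rfl
    _ = ∫ p, inner ℝ (∇ P.objective (z.x + p.1 • w)) w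
        ∂(unitUniform.prod (sphereUniform d)) := by
      rw [← map_fst_roundNoise P opt δ M t z, integral_map measurable_fst.aemeasurable
        hφ.aestronglyMeasurable]
    _ = ∫ s in (0 : ℝ)..1, inner ℝ (∇ P.objective (z.x + s • w)) w := by
      have hφ1 : Measurable fun s : ℝ => inner ℝ (∇ P.objective (z.x + s • w)) w := by fun_prop
      rw [intervalIntegral.integral_of_le zero_le_one, ← integral_Icc_eq_integral_Ioc]
      have h := integral_map (μ := unitUniform.prod (sphereUniform d))
        measurable_fst.aemeasurable hφ1.aestronglyMeasurable
      rw [(measurePreserving_fst (μ := unitUniform) (ν := sphereUniform d)).map_eq] at h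
      exact h.symm
    _ = _ := by
      have hd : ∀ s ∈ Set.uIcc (0 : ℝ) 1, HasDerivAt (fun s : ℝ => P.objective (z.x + s • w))
          (inner ℝ (∇ P.objective (z.x + s • w)) w) s := fun s _ => by
        have h1 := (hP.diff (z.x + s • w)).hasGradientAt.hasFDerivAt
        have h2 : HasDerivAt (fun s : ℝ => z.x + s • w) w s := by
          simpa using ((hasDerivAt_id s).smul_const w).const_add z.x
        have h3 := h1.comp_hasDerivAt s h2
        rwa [InnerProductSpace.toDual_apply_apply] at h3
      have hci : Continuous fun s : ℝ => inner ℝ (∇ P.objective (z.x + s • w)) w := by fun_prop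
      rw [intervalIntegral.integral_eq_sub_of_hasDerivAt hd (hci.intervalIntegrable _ _)]
      simp

end RoundKernel

/-! ### Passing from one round to the law of the whole trajectory. -/

section RunLaw

variable {d : ℕ} {S : Type*} [MeasurableSpace S]

variable {P : Problem d S} {opt : Feedback} {δ : ℝ} {M : ℕ} {η : ℝ}

open Preorder

theorem measurable_past_next (t : ℕ) : Measurable fun ω : ℕ → State d =>
    ((frestrictLe t ω : Finset.Iic t → State d), ω (t + 1)) :=
  (measurable_frestrictLe (X := fun _ => State d) t).prodMk (measurable_pi_apply _)

variable [NeZero d]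

/-- The kernel of round `t + 1` as a kernel from the past. -/
abbrev pastKernel (P : Problem d S) (opt : Feedback) (δ : ℝ) (M : ℕ) (η : ℝ) (t : ℕ) :
    Kernel (Finset.Iic t → State d) (State d) :=
  (roundKernel P opt δ M η t).comap (fun past => past ⟨t, Finset.mem_Iic.mpr le_rfl⟩)
    (measurable_pi_apply _)

theorem map_past_next_runLaw (t : ℕ) :
    (runLaw P opt δ M η).map
      (fun ω => ((frestrictLe t ω : Finset.Iic t → State d), ω (t + 1))) =
    ((runLaw P opt δ M η).map (frestrictLe (π := fun _ => State d) t)) ⊗ₘ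
      pastKernel P opt δ M η t :=
  (Kernel.map_frestrictLe_trajMeasure_compProd_eq_map_trajMeasure (X := fun _ => State d)).symm

theorem map_eval_zero_runLaw :
    (runLaw P opt δ M η).map (fun ω => ω 0) = initialLaw P δ opt := by
  have h1 : (fun ω : ℕ → State d => ω 0) =
      (MeasurableEquiv.piUnique fun _ : Finset.Iic 0 => State d) ∘
        frestrictLe (π := fun _ => State d) 0 := rfl
  rw [h1, ← Measure.map_map (MeasurableEquiv.measurable _) (by fun_prop), runLaw,
    Kernel.trajMeasure, Measure.map_comp _ _ (by fun_prop), Kernel.traj_map_frestrictLe,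
    Kernel.partialTraj_self, Measure.id_comp, Measure.map_map (by fun_prop) (by fun_prop)]
  convert Measure.map_id
  ext1 z
  exact MeasurableEquiv.apply_symm_apply _ _

/-- The tower property: given the past, the next state follows the round kernel at the last state.
-/
theorem integral_past_next {t : ℕ} {ψ : (Finset.Iic t → State d) × State d → ℝ}
    (hψ : Measurable ψ)
    (hi : Integrable (fun ω => ψ (frestrictLe t ω, ω (t + 1))) (runLaw P opt δ M η)) :
    ∫ ω, ψ (frestrictLe t ω, ω (t + 1)) ∂(runLaw P opt δ M η) =
      ∫ ω, ∫ z', ψ (frestrictLe t ω, z') ∂(roundKernel P opt δ M η t (ω t))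
        ∂(runLaw P opt δ M η) := by
  have hm := measurable_past_next (d := d) t
  have hr : Measurable (frestrictLe (π := fun _ => State d) t) := measurable_frestrictLe _
  have hi' : Integrable ψ ((runLaw P opt δ M η).map
      (fun ω => ((frestrictLe t ω : Finset.Iic t → State d), ω (t + 1)))) := by
    rw [integrable_map_measure hψ.aestronglyMeasurable hm.aemeasurable]
    exact hi
  have e := integral_map (μ := runLaw P opt δ M η) hm.aemeasurable
    (f := ψ) hψ.aestronglyMeasurable
  rw [← e, map_past_next_runLaw, Measure.integral_compProd (by rwa [← map_past_next_runLaw]),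
    integral_map hr.aemeasurable]
  · rfl
  · exact (StronglyMeasurable.integral_kernel_prod_right'
      (κ := pastKernel P opt δ M η t) hψ.stronglyMeasurable).aestronglyMeasurable

theorem ae_past_next {t : ℕ} {p : State d → State d → Prop}
    (hp : MeasurableSet {q : State d × State d | p q.1 q.2})
    (h : ∀ z, ∀ᵐ z' ∂(roundKernel P opt δ M η t z), p z z') :
    ∀ᵐ ω ∂(runLaw P opt δ M η), p (ω t) (ω (t + 1)) := by
  have hm := measurable_past_next (d := d) t
  have hs : MeasurableSet {q : (Finset.Iic t → State d) × State d |
      p (q.1 ⟨t, Finset.mem_Iic.mpr le_rfl⟩) q.2} := by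
    have : Measurable fun q : (Finset.Iic t → State d) × State d =>
        (q.1 ⟨t, Finset.mem_Iic.mpr le_rfl⟩, q.2) := by fun_prop
    exact this hp
  have h2 : ∀ᵐ q ∂((runLaw P opt δ M η).map (frestrictLe (π := fun _ => State d) t)) ⊗ₘ
      pastKernel P opt δ M η t, p (q.1 ⟨t, Finset.mem_Iic.mpr le_rfl⟩) q.2 := by
    rw [Measure.ae_compProd_iff hs]
    exact .of_forall fun past => h _
  rw [← map_past_next_runLaw] at h2
  exact ae_of_ae_map hm.aemeasurable h2

/-- Nonnegativity of `ψ` lets a bound on its conditional mean yield integrability as well as the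
estimate. -/
theorem integrable_next {t : ℕ} {ψ b : State d → ℝ} (hψ : Measurable ψ) (hψ0 : ∀ z, 0 ≤ ψ z)
    (h : ∀ z, Integrable ψ (roundKernel P opt δ M η t z) ∧
      ∫ z', ψ z' ∂(roundKernel P opt δ M η t z) ≤ b z)
    (hb : Integrable (fun ω => b (ω t)) (runLaw P opt δ M η)) :
    Integrable (fun ω => ψ (ω (t + 1))) (runLaw P opt δ M η) ∧
      ∫ ω, ψ (ω (t + 1)) ∂(runLaw P opt δ M η) ≤ ∫ ω, b (ω t) ∂(runLaw P opt δ M η) := by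
  have hm := measurable_past_next (d := d) t
  have hr : Measurable (frestrictLe (π := fun _ => State d) t) := measurable_frestrictLe _
  have hψ' : Measurable fun q : (Finset.Iic t → State d) × State d => ψ q.2 := by fun_prop
  have hsm : StronglyMeasurable fun z => ∫ z', ψ z' ∂(roundKernel P opt δ M η t z) :=
    StronglyMeasurable.integral_kernel_prod_right' (κ := roundKernel P opt δ M η t)
      (f := fun q => ψ q.2) (hψ.comp measurable_snd).stronglyMeasurable
  have hi0 : Integrable (fun ω => ∫ z', ψ z' ∂(roundKernel P opt δ M η t (ω t)))
      (runLaw P opt δ M η) := by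
    refine hb.mono' (hsm.comp_measurable (measurable_pi_apply t)).aestronglyMeasurable
      (.of_forall fun ω => ?_)
    rw [Real.norm_of_nonneg (integral_nonneg hψ0)]
    exact (h _).2
  have hi : Integrable (fun ω => ψ (ω (t + 1))) (runLaw P opt δ M η) := by
    have h2 : Integrable (fun q : (Finset.Iic t → State d) × State d => ψ q.2)
        ((runLaw P opt δ M η).map
          (fun ω => ((frestrictLe t ω : Finset.Iic t → State d), ω (t + 1)))) := by
      rw [map_past_next_runLaw, Measure.integrable_compProd_iff hψ'.aestronglyMeasurable]
      refine ⟨.of_forall fun past => (h _).1, ?_⟩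
      simp only [Real.norm_of_nonneg (hψ0 _)]
      rw [integrable_map_measure _ hr.aemeasurable]
      · exact hi0
      · exact (hsm.comp_measurable (measurable_pi_apply (X := fun _ : Finset.Iic t => State d)
          ⟨t, Finset.mem_Iic.mpr le_rfl⟩)).aestronglyMeasurable
    rw [integrable_map_measure hψ'.aestronglyMeasurable hm.aemeasurable] at h2
    exact h2
  refine ⟨hi, ?_⟩
  rw [integral_past_next (ψ := fun q => ψ q.2) hψ' hi]
  exact integral_mono hi0 hb fun ω => (h _).2

/-- A single almost sure event for all rounds, on which the later arguments are deterministic. -/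
theorem ae_run : ∀ᵐ ω ∂(runLaw P opt δ M η), ((ω 0).x = 0 ∧ (ω 0).y = 0) ∧
    ∀ t, IsRound (δ / M) η M t (ω t) (ω (t + 1)) := by
  refine Filter.Eventually.and ?_ (ae_all_iff.mpr fun t =>
    ae_past_next (measurableSet_isRound _ _ _ _) fun z => ae_isRound z)
  have hs : MeasurableSet {z : State d | z.x = 0 ∧ z.y = 0} :=
    (measurableSet_eq_fun (by fun_prop) (by fun_prop)).inter
      (measurableSet_eq_fun (by fun_prop) (by fun_prop))
  have h : ∀ᵐ z ∂(initialLaw P δ opt), z.x = 0 ∧ z.y = 0 := by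
    cases opt
    · rw [initialLaw, ae_dirac_iff hs]
      exact ⟨rfl, rfl⟩
    · rw [initialLaw, ae_map_iff (by fun_prop) hs]
      exact .of_forall fun _ => ⟨rfl, rfl⟩
  rw [← map_eval_zero_runLaw (M := M) (η := η)] at h
  exact ae_of_ae_map (measurable_pi_apply 0).aemeasurable h

end RunLaw

/-! ### Deterministic estimates along a trajectory: regret and geometry of a block. -/

section Path

variable {d : ℕ}

/-- Outside the ball, `v - u` splits into `(a • v - u) + (1 - a) • v`, and the two parts have
nonnegative inner product because `⟨v, u⟩ ≤ r ‖v‖`. -/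
theorem norm_ballProj_sub_sq_le {r : ℝ} (v u : Vec d) (hu : ‖u‖ ≤ r) :
    ‖ballProj r v - u‖ ^ 2 ≤ ‖v - u‖ ^ 2 := by
  rw [ballProj]
  split_ifs with h
  · exact le_rfl
  · have h' := not_le.mp h
    have hr : 0 ≤ r := (norm_nonneg u).trans hu
    have hv : 0 < ‖v‖ := hr.trans_lt h'
    set a := r / ‖v‖ with ha
    have ha1 : a ≤ 1 := (div_le_one hv).mpr h'.le
    have hav : a * ‖v‖ = r := div_mul_cancel₀ _ hv.ne'
    have h1 := real_inner_le_norm v u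
    have h2 : inner ℝ v u ≤ a * ‖v‖ ^ 2 := by
      calc _ ≤ ‖v‖ * ‖u‖ := h1
        _ ≤ ‖v‖ * r := by gcongr
        _ = _ := by rw [← hav]; ring
    have e1 : v - u = (a • v - u) + (1 - a) • v := by rw [sub_smul, one_smul]; abel
    rw [e1, norm_add_sq_real, real_inner_smul_right, inner_sub_left, real_inner_smul_left,
      real_inner_self_eq_norm_sq, real_inner_comm]
    have : 0 ≤ (1 - a) * (a * ‖v‖ ^ 2 - inner ℝ v u) :=
      mul_nonneg (by linarith) (by linarith)
    nlinarith [sq_nonneg ‖(1 - a) • v‖]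

/-- Regret of projected online gradient descent on a ball. -/
theorem sum_inner_sub_le_of_ballProj {r η : ℝ} (hη : 0 < η) {q g : ℕ → Vec d} (hq0 : q 0 = 0)
    {n : ℕ} (hq : ∀ i < n, q (i + 1) = ballProj r (q i - η • g i)) {u : Vec d} (hu : ‖u‖ ≤ r) :
    ∑ i ∈ Finset.range n, inner ℝ (g i) (q i - u)
      ≤ r ^ 2 / (2 * η) + η / 2 * ∑ i ∈ Finset.range n, ‖g i‖ ^ 2 := by
  -- The squared distance to the comparator is the potential: each step lowers it by `2η⟨g, q - u⟩`,
  -- up to `η²‖g‖²`.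
  have key : ∀ m ≤ n, 2 * η * ∑ i ∈ Finset.range m, inner ℝ (g i) (q i - u) + ‖q m - u‖ ^ 2
      ≤ ‖u‖ ^ 2 + η ^ 2 * ∑ i ∈ Finset.range m, ‖g i‖ ^ 2 := by
    intro m
    induction m with
    | zero => intro _; simp [hq0]
    | succ m ih =>
      intro hm
      have h1 := ih (by omega)
      have h2 := norm_ballProj_sub_sq_le (q m - η • g m) u hu
      rw [← hq m (by omega)] at h2
      have e : q m - η • g m - u = (q m - u) - η • g m := by abel
      rw [e, norm_sub_sq_real (q m - u), real_inner_smul_right, norm_smul, mul_pow,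
        Real.norm_eq_abs, sq_abs,
        real_inner_comm] at h2
      rw [Finset.sum_range_succ, Finset.sum_range_succ]
      nlinarith
  have h := key n le_rfl
  have hu2 : ‖u‖ ^ 2 ≤ r ^ 2 := pow_le_pow_left₀ (norm_nonneg u) hu 2
  have e : r ^ 2 / (2 * η) + η / 2 * ∑ i ∈ Finset.range n, ‖g i‖ ^ 2 =
      (r ^ 2 + η ^ 2 * ∑ i ∈ Finset.range n, ‖g i‖ ^ 2) / (2 * η) := by field_simp
  rw [e, le_div_iff₀ (by positivity)]
  nlinarith [sq_nonneg ‖q n - u‖]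

/-- Conversion of regret to a bound on the sum of the gradients `v i`, from estimates `g i` with
means `G i`. -/
theorem mul_norm_sum_le_of_regret {n : ℕ} {r b R : ℝ} (hr : 0 ≤ r) {v G g q : ℕ → Vec d}
    (hq : ∀ i < n, ‖q i‖ ≤ r) (hG : ∀ i < n, ‖G i - v i‖ ≤ b)
    (hR : ∀ u : Vec d, ‖u‖ ≤ r → ∑ i ∈ Finset.range n, inner ℝ (g i) (q i - u) ≤ R) :
    r * ‖∑ i ∈ Finset.range n, v i‖ ≤ -∑ i ∈ Finset.range n, inner ℝ (v i) (q i)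
      - ∑ i ∈ Finset.range n, inner ℝ (g i - G i) (q i) + 2 * n * b * r + R
      + r * ‖∑ i ∈ Finset.range n, (g i - G i)‖ := by
  set N := ∑ i ∈ Finset.range n, v i with hN
  -- The point of the ball most opposed to `N`. If `N = 0`, the convention `0⁻¹ = 0` gives `u = 0`.
  set u : Vec d := -(r * ‖N‖⁻¹) • N with hu
  have hNu : inner ℝ N u = -(r * ‖N‖) := by
    rw [hu, real_inner_smul_right, real_inner_self_eq_norm_sq]
    by_cases h : ‖N‖ = 0
    · simp [h]
    · field_simp
  have hur : ‖u‖ ≤ r := by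
    rw [hu, norm_smul, norm_neg, Real.norm_of_nonneg (by positivity), mul_assoc]
    exact mul_le_of_le_one_right hr inv_mul_le_one
  have h1 := hR u hur
  have h3 : ∀ i ∈ Finset.range n, -inner ℝ (v i) u ≤ -inner ℝ (v i) (q i)
      - inner ℝ (g i - G i) (q i) + 2 * b * r + inner ℝ (g i) (q i - u)
      + inner ℝ (g i - G i) u := fun i hi => by
    have hi' := Finset.mem_range.mp hi
    -- The bias meets `q i - u`, of norm at most `2 * r`. The noise is split: against `q i`, which
    -- in the application is fixed before the round, it will have mean zero; against `u` only
    -- Cauchy–Schwarz is available.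
    have e : -inner ℝ (v i) u = -inner ℝ (v i) (q i) - inner ℝ (g i - G i) (q i)
        - inner ℝ (G i - v i) (q i - u) + inner ℝ (g i) (q i - u)
        + inner ℝ (g i - G i) u := by
      simp only [inner_sub_left, inner_sub_right]; ring
    have h4 : |inner ℝ (G i - v i) (q i - u)| ≤ b * (2 * r) :=
      (abs_real_inner_le_norm _ _).trans (mul_le_mul (hG i hi')
        ((norm_sub_le _ _).trans (by linarith [hq i hi'])) (norm_nonneg _)
        ((norm_nonneg _).trans (hG i hi')))
    rw [e]
    linarith [(abs_le.mp h4).1]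
  have h5 := Finset.sum_le_sum h3
  simp only [Finset.sum_add_distrib, Finset.sum_sub_distrib, Finset.sum_neg_distrib,
    Finset.sum_const, Finset.card_range, nsmul_eq_mul] at h5
  rw [← sum_inner, ← hN, hNu, ← sum_inner (f := fun i => g i - G i)] at h5
  have h6 : inner ℝ (∑ i ∈ Finset.range n, (g i - G i)) u
      ≤ r * ‖∑ i ∈ Finset.range n, (g i - G i)‖ := by
    refine (real_inner_le_norm _ _).trans ?_
    rw [mul_comm]
    gcongr
  linarith

variable {r η : ℝ} {M : ℕ} {ω : ℕ → State d}

theorem norm_increment_le (hr : 0 ≤ r) (h : ∀ t, IsRound r η M t (ω t) (ω (t + 1))) (t : ℕ) :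
    ‖increment M t (ω t)‖ ≤ r := by
  rw [increment]
  split_ifs with hM
  · simpa using hr
  -- Round `0` always resets, as `M ∣ 0`; hence a nonreset increment comes from an earlier
  -- projection.
  · obtain ⟨s, rfl⟩ : ∃ s, t = s + 1 := Nat.exists_eq_succ_of_ne_zero (by rintro rfl; simp at hM)
    rw [(h s).Δ_eq]
    simpa using ballProj_mem hr (increment M s (ω s) - η • (ω (s + 1)).g)

theorem norm_x_sub_y_le (hr : 0 ≤ r) (h0 : (ω 0).x = 0 ∧ (ω 0).y = 0)
    (h : ∀ t, IsRound r η M t (ω t) (ω (t + 1))) (t : ℕ) :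
    ‖(ω t).x - (ω t).y‖ ≤ r := by
  cases t with
  | zero => simpa [h0.1, h0.2] using hr
  | succ t =>
    rw [norm_sub_rev]
    exact (h t).y_sub_right.trans (norm_increment_le hr h t)

theorem norm_x_sub_x_le (hr : 0 ≤ r) (h : ∀ t, IsRound r η M t (ω t) (ω (t + 1))) (t n : ℕ) :
    ‖(ω (t + n)).x - (ω t).x‖ ≤ n * r := by
  induction n with
  | zero => simp
  | succ n ih =>
    have e : (ω (t + (n + 1))).x - (ω t).x =
        ((ω (t + n)).x - (ω t).x) + increment M (t + n) (ω (t + n)) := by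
      rw [← add_assoc, (h (t + n)).x_eq]; abel
    rw [e]
    push_cast
    linarith [norm_add_le ((ω (t + n)).x - (ω t).x) (increment M (t + n) (ω (t + n))),
      norm_increment_le hr h (t + n)]

theorem norm_y_sub_y_le (hr : 0 ≤ r) (h : ∀ t, IsRound r η M t (ω t) (ω (t + 1))) {t i j : ℕ}
    (hi : i < M) (hj : j < M) : ‖(ω (t + i + 1)).y - (ω (t + j + 1)).y‖ ≤ M * r := by
  wlog hij : j ≤ i generalizing i j
  · rw [norm_sub_rev]
    exact this hj hi (by omega)
  obtain rfl | hlt := hij.eq_or_lt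
  · simp; positivity
  obtain ⟨n, rfl⟩ : ∃ n, i = j + 1 + n := ⟨i - (j + 1), by omega⟩
  have h1 := (h (t + (j + 1 + n))).y_sub_left.trans (norm_increment_le hr h _)
  have h2 := (h (t + j)).y_sub_right.trans (norm_increment_le hr h _)
  have h3 := norm_x_sub_x_le hr h (t + j + 1) n
  have e : t + (j + 1 + n) = t + j + 1 + n := by omega
  rw [e] at h1 ⊢
  have e2 : (ω (t + j + 1 + n + 1)).y - (ω (t + j + 1)).y =
      ((ω (t + j + 1 + n + 1)).y - (ω (t + j + 1 + n)).x)
      + ((ω (t + j + 1 + n)).x - (ω (t + j + 1)).x)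
      - ((ω (t + j + 1)).y - (ω (t + j + 1)).x) := by abel
  -- Between the two evaluation points lie `n` full increments and two partial ones, and `j + 1 + n
  -- < M`.
  have hn : ((n : ℝ) + 2) ≤ M := by exact_mod_cast (by omega : n + 2 ≤ M)
  have h4 := norm_add_le ((ω (t + j + 1 + n + 1)).y - (ω (t + j + 1 + n)).x)
    ((ω (t + j + 1 + n)).x - (ω (t + j + 1)).x)
  rw [e2]
  calc _ ≤ r + n * r + r := (norm_sub_le _ _).trans (by linarith)
    _ = (n + 2) * r := by ring
    _ ≤ M * r := by gcongr

theorem block_regret (hη : 0 < η) (h : ∀ t, IsRound r η M t (ω t) (ω (t + 1))) (k : ℕ)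
    {u : Vec d} (hu : ‖u‖ ≤ r) :
    ∑ i ∈ Finset.range M, inner ℝ (ω (k * M + i + 1)).g
        (increment M (k * M + i) (ω (k * M + i)) - u)
      ≤ r ^ 2 / (2 * η) + η / 2 * ∑ i ∈ Finset.range M, ‖(ω (k * M + i + 1)).g‖ ^ 2 := by
  -- The reset is the starting point `q 0 = 0`, and no other index below `M` resets. At `i = M` the
  -- unreset projection is kept, as the last descent step requires.
  let q : ℕ → Vec d := fun i => if i = 0 then 0 else (ω (k * M + i)).Δ
  have hq : ∀ i < M, increment M (k * M + i) (ω (k * M + i)) = q i := fun i hi => by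
    rw [increment]
    simp only [q, Nat.dvd_add_right (Dvd.intro_left k rfl)]
    by_cases h0 : i = 0
    · simp [h0]
    · rw [if_neg h0, if_neg fun hd => h0 (Nat.eq_zero_of_dvd_of_lt hd hi)]
  have h1 := sum_inner_sub_le_of_ballProj (r := r) hη (q := q)
    (g := fun i => (ω (k * M + i + 1)).g) (by simp [q]) (n := M) (fun i hi => by
      rw [← hq i hi, ← (h (k * M + i)).Δ_eq]; simp [q, add_assoc]) hu
  refine le_trans (le_of_eq (Finset.sum_congr rfl fun i hi => ?_)) h1
  rw [hq i (Finset.mem_range.mp hi)]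

theorem blockAverage_succ (M : ℕ) (ω : ℕ → State d) (k : ℕ) :
    blockAverage M ω (k + 1) = (1 / (M : ℝ)) • ∑ i ∈ Finset.range M, (ω (k * M + i + 1)).y := by
  rw [blockAverage, Nat.add_sub_cancel]
  congr 1
  refine (Finset.sum_nbij (fun i => k * M + i + 1) ?_ ?_ ?_ fun _ _ => rfl).symm
  · intro i hi
    rw [Finset.mem_range] at hi
    rw [Finset.mem_Icc, Nat.succ_mul]
    omega
  · intro i _ j _ hij
    simpa using hij
  · intro t ht
    rw [Finset.mem_coe, Finset.mem_Icc, Nat.succ_mul] at ht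
    exact ⟨t - (k * M + 1), by simp; omega, by dsimp only; omega⟩

/-- Each point of the block is within `M * r` of the average, so each gradient is within `Lg * (M *
r)` of the gradient there. -/
theorem norm_map_blockAverage_le {f : Vec d → Vec d} {Lg : ℝ} (hLg : 0 ≤ Lg)
    (hf : ∀ x y, ‖f x - f y‖ ≤ Lg * ‖x - y‖)
    (hM : 0 < M) (hr : 0 ≤ r) (h : ∀ t, IsRound r η M t (ω t) (ω (t + 1))) (k : ℕ) :
    ‖f (blockAverage M ω (k + 1))‖
      ≤ 1 / M * ‖∑ i ∈ Finset.range M, f (ω (k * M + i + 1)).y‖ + Lg * (M * r) := by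
  have hM' : (0 : ℝ) < M := by exact_mod_cast hM
  set ybar := blockAverage M ω (k + 1) with hy
  have hcard : ∀ v : Vec d, v = (1 / (M : ℝ)) • ∑ _i ∈ Finset.range M, v := fun v => by
    rw [Finset.sum_const, Finset.card_range, ← Nat.cast_smul_eq_nsmul ℝ, smul_smul,
      one_div_mul_cancel hM'.ne', one_smul]
  have havg : ∀ (w : ℕ → Vec d) (c : ℝ), (∀ i < M, ‖w i‖ ≤ c) →
      ‖(1 / (M : ℝ)) • ∑ i ∈ Finset.range M, w i‖ ≤ c := fun w c hw => by
    rw [norm_smul, Real.norm_of_nonneg (by positivity), one_div, inv_mul_le_iff₀ hM']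
    refine (norm_sum_le_of_le _ fun i hi => hw i (Finset.mem_range.mp hi)).trans ?_
    simp
  have hyi : ∀ i < M, ‖ybar - (ω (k * M + i + 1)).y‖ ≤ M * r := fun i hi => by
    rw [hcard (ω (k * M + i + 1)).y, hy, blockAverage_succ, ← smul_sub, ← Finset.sum_sub_distrib]
    exact havg _ _ fun j hj => norm_y_sub_y_le hr h hj hi
  have h1 : f ybar = (1 / (M : ℝ)) • ∑ i ∈ Finset.range M, f (ω (k * M + i + 1)).y
      + (1 / (M : ℝ)) • ∑ i ∈ Finset.range M, (f ybar - f (ω (k * M + i + 1)).y) := by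
    rw [← smul_add, ← Finset.sum_add_distrib]
    simp only [add_sub_cancel]
    exact hcard _
  rw [h1]
  refine (norm_add_le _ _).trans (add_le_add ?_ ?_)
  · rw [norm_smul, Real.norm_of_nonneg (by positivity)]
  · exact havg _ _ fun i hi => (hf _ _).trans (by gcongr; exact hyi i hi)

end Path

/-! ### Moments along the run and the martingale structure of the noise. -/

section Moments

variable {d : ℕ} [NeZero d] {S : Type*} [MeasurableSpace S] {P : Problem d S} {opt : Feedback}
  {δ : ℝ} {M : ℕ} {η σ L Lg : ℝ}

theorem integrable_inner_of_memLp_two {α E : Type*} [MeasurableSpace α] {μ : Measure α}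
    [NormedAddCommGroup E] [InnerProductSpace ℝ E] {X Y : α → E} (hX : MemLp X 2 μ)
    (hY : MemLp Y 2 μ) : Integrable (fun a => inner ℝ (X a) (Y a)) μ :=
  (hX.norm.integrable_mul hY.norm).mono' (hX.1.inner hY.1)
    (.of_forall fun _ => norm_inner_le_norm _ _)

open Preorder

/-- The initialization query is at distance `δ` from `y_0 = 0`, so the stored value starts with the
same error bound as in later rounds. -/
theorem integral_residual_sq_initialLaw_le (hP : P.Regular σ L Lg) (hδ : 0 < δ) :
    Integrable (fun z => residual P opt z ^ 2) (initialLaw P δ opt) ∧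
      ∫ z, residual P opt z ^ 2 ∂(initialLaw P δ opt) ≤ 2 * (σ ^ 2 + L ^ 2 * δ ^ 2) := by
  have hA : 0 ≤ 2 * (σ ^ 2 + L ^ 2 * δ ^ 2) := by positivity
  cases opt
  · simpa [residual] using hA
  suffices h : ∫⁻ z, ENNReal.ofReal (residual P .onePoint z ^ 2) ∂(initialLaw P δ .onePoint)
      ≤ ENNReal.ofReal (2 * (σ ^ 2 + L ^ 2 * δ ^ 2)) by
    obtain ⟨h1, h2⟩ := memLp_two_of_lintegral_sq_le (measurable_residual hP) h hA
    exact ⟨h1.integrable_sq, h2⟩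
  have hm := measurable_residual (opt := .onePoint) hP
  have hφ : Measurable fun u : Metric.sphere (0 : Vec d) 1 => (0 : Vec d) + δ • (u : Vec d) := by
    fun_prop
  rw [initialLaw, lintegral_map (by fun_prop) (by fun_prop),
    Measure.lintegral_bind (Kernel.aemeasurable _) (Measurable.aemeasurable (by fun_prop)),
    lintegral_map (Measurable.lintegral_kernel (by fun_prop)) hφ]
  calc _ ≤ ∫⁻ _u, ENNReal.ofReal (2 * (σ ^ 2 + L ^ 2 * δ ^ 2)) ∂(sphereUniform d) := by
        refine lintegral_mono fun u => ?_
        set y : Vec d := 0 + δ • (u : Vec d) with hy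
        have hyn : ‖y - 0‖ = δ := by
          have hu : ‖(u : Vec d)‖ = 1 := by simp
          rw [hy, zero_add, sub_zero, norm_smul, hu, mul_one, Real.norm_of_nonneg hδ.le]
        have hb := hP.lip y 0
        rw [hyn] at hb
        have hb2 : (P.objective y - P.objective 0) ^ 2 ≤ L ^ 2 * δ ^ 2 := by
          rw [← mul_pow, ← sq_abs]; exact pow_le_pow_left₀ (abs_nonneg _) hb 2
        have hv := hP.lintegral_query_sub_sq_le y
        calc _ ≤ ∫⁻ v, (ENNReal.ofReal 2 * ENNReal.ofReal ((v - P.objective y) ^ 2)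
              + ENNReal.ofReal (2 * (L ^ 2 * δ ^ 2))) ∂(P.query y) := by
              refine lintegral_mono fun v => ?_
              rw [← ENNReal.ofReal_mul (by norm_num),
                ← ENNReal.ofReal_add (by positivity) (by positivity)]
              refine ENNReal.ofReal_le_ofReal ?_
              change (v - P.objective 0) ^ 2 ≤ _
              nlinarith [sq_nonneg ((v - P.objective y) - (P.objective y - P.objective 0))]
          _ ≤ ENNReal.ofReal 2 * ENNReal.ofReal (σ ^ 2) + ENNReal.ofReal (2 * (L ^ 2 * δ ^ 2)) := by
              rw [lintegral_add_right _ (by fun_prop), lintegral_const_mul _ (by fun_prop)]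
              simp only [lintegral_const, measure_univ, mul_one]
              gcongr
          _ = _ := by
              rw [← ENNReal.ofReal_mul (by norm_num),
                ← ENNReal.ofReal_add (by positivity) (by positivity)]
              congr 1; ring
    _ = _ := by simp

theorem integral_residual_sq_run_le (hP : P.Regular σ L Lg) (hδ : 0 < δ) (t : ℕ) :
    Integrable (fun ω => residual P opt (ω t) ^ 2) (runLaw P opt δ M η) ∧
      ∫ ω, residual P opt (ω t) ^ 2 ∂(runLaw P opt δ M η) ≤ 2 * (σ ^ 2 + L ^ 2 * δ ^ 2) := by
  have hm : Measurable fun z => residual P opt z ^ 2 := (measurable_residual hP).pow_const 2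
  cases t with
  | zero =>
    have h := integral_residual_sq_initialLaw_le (opt := opt) hP hδ
    rw [← map_eval_zero_runLaw (M := M) (η := η), integrable_map_measure hm.aestronglyMeasurable
      (measurable_pi_apply 0).aemeasurable, integral_map (measurable_pi_apply 0).aemeasurable
      hm.aestronglyMeasurable] at h
    exact h
  | succ t =>
    have h := integrable_next (P := P) (opt := opt) (δ := δ) (M := M) (η := η) (t := t) hm
      (fun _ => sq_nonneg _) (fun z => integral_residual_sq_le hP hδ z) (integrable_const _)
    simpa using h

/-- Upper bound for the second moments of the gradient estimates and of their errors. -/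
def noiseLevel (d : ℕ) (δ σ L Lg : ℝ) : ℝ :=
  48 * (d / δ) ^ 2 * (σ ^ 2 + L ^ 2 * δ ^ 2) + 2 * (L + Lg * δ) ^ 2

theorem integral_norm_g_sq_run_le (hP : P.Regular σ L Lg) (hδ : 0 < δ) (hM : 1 ≤ M) (t : ℕ) :
    Integrable (fun ω => ‖(ω (t + 1)).g‖ ^ 2) (runLaw P opt δ M η) ∧
      ∫ ω, ‖(ω (t + 1)).g‖ ^ 2 ∂(runLaw P opt δ M η)
        ≤ 24 * (d / δ) ^ 2 * (σ ^ 2 + L ^ 2 * δ ^ 2) := by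
  have hm := measurable_residual (opt := opt) hP
  obtain ⟨h1, h2⟩ := integral_residual_sq_run_le (opt := opt) (M := M) (η := η) hP hδ t
  have hD : 0 ≤ δ / M := by positivity
  have hDδ : δ / M ≤ δ := div_le_self hδ.le (by exact_mod_cast hM)
  set ρ : State d → ℝ := fun z => ‖increment M t z‖ + ‖z.x - z.y‖ with hρ
  have hρm : Measurable ρ := by fun_prop
  -- Consecutive evaluation points are at most `2δ/M` apart, also across a block boundary.
  have hρb : ∀ᵐ ω ∂(runLaw P opt δ M η), ρ (ω t) ^ 2 ≤ (2 * δ) ^ 2 := by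
    filter_upwards [ae_run (P := P) (opt := opt) (δ := δ) (M := M) (η := η)] with ω hω
    refine pow_le_pow_left₀ (by positivity) ?_ 2
    linarith [norm_increment_le hD hω.2 t, norm_x_sub_y_le hD hω.1 hω.2 t]
  have hρi : Integrable (fun ω => ρ (ω t) ^ 2) (runLaw P opt δ M η) := by
    refine Integrable.of_bound (Measurable.aestronglyMeasurable (by fun_prop)) ((2 * δ) ^ 2) ?_
    filter_upwards [hρb] with ω hω
    rwa [Real.norm_of_nonneg (sq_nonneg _)]
  have hρl : ∫ ω, ρ (ω t) ^ 2 ∂(runLaw P opt δ M η) ≤ (2 * δ) ^ 2 := by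
    refine (integral_mono_ae hρi (integrable_const _) hρb).trans ?_
    simp
  have i1 : Integrable (fun ω => 6 * (σ ^ 2 + L ^ 2 * δ ^ 2) + 3 * L ^ 2 * ρ (ω t) ^ 2)
      (runLaw P opt δ M η) := (integrable_const _).add (hρi.const_mul _)
  have i2 : Integrable (fun ω => 3 * residual P opt (ω t) ^ 2) (runLaw P opt δ M η) :=
    h1.const_mul _
  obtain ⟨h3, h4⟩ := integrable_next (P := P) (opt := opt) (δ := δ) (M := M) (η := η) (t := t)
    (ψ := fun z => ‖z.g‖ ^ 2) (b := fun z => (d / δ) ^ 2 * (6 * (σ ^ 2 + L ^ 2 * δ ^ 2)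
      + 3 * L ^ 2 * ρ z ^ 2 + 3 * residual P opt z ^ 2)) (by fun_prop) (fun _ => sq_nonneg _)
    (fun z => integral_norm_g_sq_le hP hδ z fun s hs => by
      have := norm_sub_le_norm_sub_add_norm_sub (evalPoint M t z s) z.x z.y
      linarith [(norm_evalPoint_sub_le (M := M) (t := t) z hs).1])
    ((i1.add i2).const_mul _)
  refine ⟨h3, h4.trans ?_⟩
  rw [integral_const_mul, integral_add i1 i2, integral_add (integrable_const _) (hρi.const_mul _),
    integral_const_mul, integral_const_mul, integral_const]
  simp only [probReal_univ, one_smul]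
  calc _ ≤ (d / δ) ^ 2 * (6 * (σ ^ 2 + L ^ 2 * δ ^ 2) + 3 * L ^ 2 * (2 * δ) ^ 2
        + 3 * (2 * (σ ^ 2 + L ^ 2 * δ ^ 2))) := by
        gcongr
        rw [integral_const_mul]
        gcongr
    -- The bracket equals `12σ² + 24L²δ²`.
    _ ≤ (d / δ) ^ 2 * (24 * (σ ^ 2 + L ^ 2 * δ ^ 2)) := by
        gcongr
        nlinarith [sq_nonneg σ]
    _ = _ := by ring

/-- The error of the gradient estimate. -/
def noise (P : Problem d S) (δ : ℝ) (z : State d) : Vec d :=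
  z.g - smoothedGrad δ P.objective z.y

theorem measurable_noise (hP : P.Regular σ L Lg) (δ : ℝ) : Measurable (noise P δ) := by
  have hG := (hP.continuous_smoothedGrad δ).measurable
  unfold noise
  fun_prop

theorem memLp_noise (hP : P.Regular σ L Lg) (hδ : 0 < δ) (hM : 1 ≤ M) (t : ℕ) :
    MemLp (fun ω => noise P δ (ω (t + 1))) 2 (runLaw P opt δ M η) ∧
      ∫ ω, ‖noise P δ (ω (t + 1))‖ ^ 2 ∂(runLaw P opt δ M η) ≤ noiseLevel d δ σ L Lg := by
  have hm := measurable_noise hP δ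
  have hG := (hP.continuous_smoothedGrad δ).measurable
  obtain ⟨h1, h2⟩ := integral_norm_g_sq_run_le (opt := opt) (η := η) hP hδ hM t
  have h3 : MemLp (fun ω : ℕ → State d => (ω (t + 1)).g) 2 (runLaw P opt δ M η) :=
    (memLp_two_iff_integrable_sq_norm (Measurable.aestronglyMeasurable (by fun_prop))).mpr h1
  have h4 : MemLp (fun ω : ℕ → State d => smoothedGrad δ P.objective (ω (t + 1)).y) 2
      (runLaw P opt δ M η) := MemLp.of_bound (Measurable.aestronglyMeasurable (by fun_prop)) _
        (.of_forall fun ω => hP.norm_smoothedGrad_le hδ _)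
  have h5 : MemLp (fun ω => noise P δ (ω (t + 1))) 2 (runLaw P opt δ M η) := h3.sub h4
  refine ⟨h5, ?_⟩
  calc _ ≤ ∫ ω, (2 * ‖(ω (t + 1)).g‖ ^ 2 + 2 * (L + Lg * δ) ^ 2) ∂(runLaw P opt δ M η) := by
        refine integral_mono h5.norm.integrable_sq ((h1.const_mul _).add (integrable_const _))
          fun ω => ?_
        have e1 := norm_sub_le (ω (t + 1)).g (smoothedGrad δ P.objective (ω (t + 1)).y)
        have e2 := hP.norm_smoothedGrad_le hδ (ω (t + 1)).y
        have e3 : ‖noise P δ (ω (t + 1))‖ ^ 2 ≤ (‖(ω (t + 1)).g‖ + (L + Lg * δ)) ^ 2 :=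
          pow_le_pow_left₀ (norm_nonneg _) (by rw [noise]; linarith) 2
        simp only
        nlinarith [sq_nonneg (‖(ω (t + 1)).g‖ - (L + Lg * δ))]
    _ ≤ _ := by
        rw [integral_add (h1.const_mul _) (integrable_const _), integral_const_mul, integral_const]
        simp only [probReal_univ, one_smul, noiseLevel]
        linarith

/-- The errors of the gradient estimates are martingale differences. -/
theorem integral_inner_noise_eq_zero (hP : P.Regular σ L Lg) (hδ : 0 < δ) (hM : 1 ≤ M) {t : ℕ}
    {Z : (ℕ → State d) → Vec d} (hZm : Measurable Z)
    (hZ : ∀ ω ω', (∀ i ≤ t, ω i = ω' i) → Z ω = Z ω')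
    (hZi : MemLp Z 2 (runLaw P opt δ M η)) :
    Integrable (fun ω => inner ℝ (noise P δ (ω (t + 1))) (Z ω)) (runLaw P opt δ M η) ∧
      ∫ ω, inner ℝ (noise P δ (ω (t + 1))) (Z ω) ∂(runLaw P opt δ M η) = 0 := by
  have hm := measurable_noise hP δ
  have hi : Integrable (fun ω => inner ℝ (noise P δ (ω (t + 1))) (Z ω)) (runLaw P opt δ M η) :=
    integrable_inner_of_memLp_two (memLp_noise hP hδ hM t).1 hZi
  refine ⟨hi, ?_⟩
  -- A finite past is extended by zero states. By `hZ`, `Z` cannot see the extension, so it becomes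
  -- a function of the past and is constant in the inner integral.
  let e : (Finset.Iic t → State d) → ℕ → State d := fun past i =>
    if h : i ≤ t then past ⟨i, Finset.mem_Iic.mpr h⟩ else 0
  have he : Measurable e := by
    refine measurable_pi_lambda _ fun i => ?_
    by_cases h : i ≤ t
    · simp only [e, h, dif_pos]; fun_prop
    · simp only [e, h, dif_neg, not_false_eq_true]; fun_prop
  have heZ : ∀ ω : ℕ → State d, Z (e (frestrictLe t ω)) = Z ω := fun ω =>
    hZ _ _ fun i hi => by simp [e, hi]
  have h := integral_past_next (P := P) (opt := opt) (δ := δ) (M := M) (η := η) (t := t)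
    (ψ := fun q => inner ℝ (noise P δ q.2) (Z (e q.1))) (by fun_prop) (by simpa only [heZ] using hi)
  simp only [heZ] at h
  rw [h]
  refine integral_eq_zero_of_ae (.of_forall fun ω => ?_)
  exact integral_inner_g_sub_smoothedGrad hP hδ (ω t) (Z ω)

/-- The partial sum is determined by the past, hence orthogonal to the next error: second moments
add up without cross terms. -/
theorem integral_norm_sum_noise_sq_le (hP : P.Regular σ L Lg) (hδ : 0 < δ) (hM : 1 ≤ M)
    (b n : ℕ) :
    MemLp (fun ω => ∑ i ∈ Finset.range n, noise P δ (ω (b + i + 1))) 2 (runLaw P opt δ M η) ∧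
    ∫ ω, ‖∑ i ∈ Finset.range n, noise P δ (ω (b + i + 1))‖ ^ 2 ∂(runLaw P opt δ M η)
      ≤ n * noiseLevel d δ σ L Lg := by
  have hm := measurable_noise hP δ
  induction n with
  | zero => simp
  | succ n ih =>
    obtain ⟨h1, h2⟩ := ih
    obtain ⟨h3, h4⟩ := memLp_noise (opt := opt) (η := η) hP hδ hM (b + n)
    obtain ⟨h5, h6⟩ := integral_inner_noise_eq_zero (opt := opt) (η := η) hP hδ hM (t := b + n)
      (Z := fun ω => ∑ i ∈ Finset.range n, noise P δ (ω (b + i + 1))) (by fun_prop)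
      (fun ω ω' h => Finset.sum_congr rfl fun i hi => by
        rw [h _ (by have := Finset.mem_range.mp hi; omega)]) h1
    simp only [Finset.sum_range_succ]
    refine ⟨h1.add h3, ?_⟩
    have e : ∀ ω : ℕ → State d, ‖∑ i ∈ Finset.range n, noise P δ (ω (b + i + 1))
        + noise P δ (ω (b + n + 1))‖ ^ 2 =
        ‖∑ i ∈ Finset.range n, noise P δ (ω (b + i + 1))‖ ^ 2
        + 2 * inner ℝ (noise P δ (ω (b + n + 1)))
          (∑ i ∈ Finset.range n, noise P δ (ω (b + i + 1)))
        + ‖noise P δ (ω (b + n + 1))‖ ^ 2 := fun ω => by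
      rw [norm_add_sq_real, real_inner_comm]
    simp only [e]
    have i1 := h1.norm.integrable_sq
    have i2 := h5.const_mul 2
    have i3 := i1.add i2
    simp only [Pi.add_def] at i3
    rw [integral_add i3 h3.norm.integrable_sq, integral_add i1 i2, integral_const_mul, h6]
    push_cast
    linarith

/-- The inequality `a ≤ a²/(2s) + s/2` replaces Jensen and lets `s` be any upper bound for the root
mean square. -/
theorem integral_norm_sum_noise_le (hP : P.Regular σ L Lg) (hδ : 0 < δ) (hM : 1 ≤ M)
    (b n : ℕ) {s : ℝ} (hs : 0 < s) (hns : n * noiseLevel d δ σ L Lg ≤ s ^ 2) :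
    Integrable (fun ω => ‖∑ i ∈ Finset.range n, noise P δ (ω (b + i + 1))‖) (runLaw P opt δ M η) ∧
    ∫ ω, ‖∑ i ∈ Finset.range n, noise P δ (ω (b + i + 1))‖ ∂(runLaw P opt δ M η) ≤ s := by
  obtain ⟨h1, h2⟩ := integral_norm_sum_noise_sq_le (opt := opt) (η := η) hP hδ hM b n
  have hi := (h1.integrable one_le_two).norm
  refine ⟨hi, ?_⟩
  calc _ ≤ ∫ ω, (1 / (2 * s) * ‖∑ i ∈ Finset.range n, noise P δ (ω (b + i + 1))‖ ^ 2 + s / 2)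
        ∂(runLaw P opt δ M η) := by
        refine integral_mono hi ((h1.norm.integrable_sq.const_mul _).add (integrable_const _))
          fun ω => ?_
        set a := ‖∑ i ∈ Finset.range n, noise P δ (ω (b + i + 1))‖
        have : 1 / (2 * s) * a ^ 2 + s / 2 - a = (a - s) ^ 2 / (2 * s) := by field_simp; ring
        have h0 : 0 ≤ (a - s) ^ 2 / (2 * s) := by positivity
        simp only
        linarith
    _ ≤ 1 / (2 * s) * s ^ 2 + s / 2 := by
        rw [integral_add (h1.norm.integrable_sq.const_mul _) (integrable_const _),
          integral_const_mul, integral_const]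
        simp only [probReal_univ, one_smul]
        gcongr
        exact h2.trans hns
    _ = s := by field_simp; ring

theorem integrable_objective_x (hP : P.Regular σ L Lg) (hδ : 0 < δ) (t : ℕ) :
    Integrable (fun ω => P.objective (ω t).x) (runLaw P opt δ M η) := by
  have hc := hP.continuous_objective.measurable
  have hD : 0 ≤ δ / M := by positivity
  have h1 : Integrable (fun ω : ℕ → State d => P.objective (ω t).x - P.objective 0)
      (runLaw P opt δ M η) := by
    refine Integrable.of_bound (Measurable.aestronglyMeasurable (by fun_prop))
      (L * (t * (δ / M))) ?_
    filter_upwards [ae_run (P := P) (opt := opt) (δ := δ) (M := M) (η := η)] with ω hω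
    have h := norm_x_sub_x_le hD hω.2 0 t
    rw [hω.1.1, zero_add] at h
    exact (hP.lip _ _).trans (mul_le_mul_of_nonneg_left h hP.L_nonneg)
  refine (h1.add (integrable_const (P.objective 0))).congr (.of_forall fun ω => ?_)
  simp

theorem memLp_increment (hδ : 0 < δ) (t : ℕ) :
    MemLp (fun ω => increment M t (ω t)) 2 (runLaw P opt δ M η) := by
  refine MemLp.of_bound (Measurable.aestronglyMeasurable (by fun_prop)) (δ / M) ?_
  filter_upwards [ae_run (P := P) (opt := opt) (δ := δ) (M := M) (η := η)] with ω hω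
  exact norm_increment_le (by positivity) hω.2 t

theorem integral_inner_gradient_increment_run (hP : P.Regular σ L Lg) (hδ : 0 < δ) (t : ℕ) :
    Integrable (fun ω => inner ℝ (∇ P.objective (ω (t + 1)).y) (increment M t (ω t)))
      (runLaw P opt δ M η) ∧
    ∫ ω, inner ℝ (∇ P.objective (ω (t + 1)).y) (increment M t (ω t)) ∂(runLaw P opt δ M η)
      = ∫ ω, P.objective (ω (t + 1)).x ∂(runLaw P opt δ M η)
        - ∫ ω, P.objective (ω t).x ∂(runLaw P opt δ M η) := by
  have hg := hP.continuous_gradient.measurable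
  have h1 : MemLp (fun ω : ℕ → State d => ∇ P.objective (ω (t + 1)).y) 2 (runLaw P opt δ M η) :=
    MemLp.of_bound (Measurable.aestronglyMeasurable (by fun_prop)) L
      (.of_forall fun ω => hP.norm_gradient_le _)
  have hi := integrable_inner_of_memLp_two h1
    (memLp_increment (P := P) (opt := opt) (M := M) (η := η) hδ t)
  refine ⟨hi, ?_⟩
  have h2 := integral_past_next (t := t) (ψ := fun q => inner ℝ (∇ P.objective q.2.y)
    (increment M t (q.1 ⟨t, Finset.mem_Iic.mpr le_rfl⟩))) (by fun_prop) hi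
  refine h2.trans ?_
  rw [← integral_sub (integrable_objective_x hP hδ _) (integrable_objective_x hP hδ _)]
  refine integral_congr_ae ?_
  filter_upwards [ae_run (P := P) (opt := opt) (δ := δ) (M := M) (η := η)] with ω hω
  rw [(hω.2 t).x_eq]
  exact integral_inner_gradient_increment hP (ω t)

end Moments

/-! ### Expected gradient norm of a block and of the output. -/

section Convergence

variable {d : ℕ}

theorem measurable_blockAverage (M k : ℕ) :
    Measurable fun ω : ℕ → State d => blockAverage M ω k := by
  unfold blockAverage
  fun_prop

variable [NeZero d] {S : Type*} [MeasurableSpace S] {P : Problem d S} {opt : Feedback}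
  {δ : ℝ} {M : ℕ} {η σ L Lg : ℝ}

theorem integral_linear_combination {α : Type*} [MeasurableSpace α] {μ : Measure α}
    [IsProbabilityMeasure μ] {A₁ A₂ A₃ A₄ : α → ℝ} (h₁ : Integrable A₁ μ) (h₂ : Integrable A₂ μ)
    (h₃ : Integrable A₃ μ) (h₄ : Integrable A₄ μ) (c a b : ℝ) :
    Integrable (fun ω => -A₁ ω - A₂ ω + c + a * A₃ ω + b * A₄ ω) μ ∧
    ∫ ω, (-A₁ ω - A₂ ω + c + a * A₃ ω + b * A₄ ω) ∂μ =
      -∫ ω, A₁ ω ∂μ - ∫ ω, A₂ ω ∂μ + c + a * ∫ ω, A₃ ω ∂μ + b * ∫ ω, A₄ ω ∂μ := by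
  have i1 : Integrable (fun ω => -A₁ ω - A₂ ω) μ := h₁.neg.sub h₂
  have i2 : Integrable (fun ω => -A₁ ω - A₂ ω + c) μ := i1.add (integrable_const _)
  have i3 : Integrable (fun ω => -A₁ ω - A₂ ω + c + a * A₃ ω) μ := i2.add (h₃.const_mul a)
  have i0 : Integrable (fun ω => -A₁ ω) μ := h₁.neg
  refine ⟨i3.add (h₄.const_mul b), ?_⟩
  rw [integral_add i3 (h₄.const_mul b), integral_add i2 (h₃.const_mul a),
    integral_add i1 (integrable_const _), integral_sub i0 h₂, integral_neg, integral_const_mul,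
    integral_const_mul, integral_const]
  simp

theorem integrable_norm_sum_gradient (hP : P.Regular σ L Lg) (b n : ℕ) :
    Integrable (fun ω => ‖∑ i ∈ Finset.range n, ∇ P.objective (ω (b + i + 1)).y‖)
      (runLaw P opt δ M η) := by
  have hg := hP.continuous_gradient.measurable
  refine Integrable.of_bound (Measurable.aestronglyMeasurable (by fun_prop)) (n * L)
    (.of_forall fun ω => ?_)
  rw [norm_norm]
  refine (norm_sum_le_of_le _ fun i _ => hP.norm_gradient_le _).trans ?_
  simp

theorem integral_norm_sum_gradient_le (hP : P.Regular σ L Lg) (hδ : 0 < δ) (hM : 1 ≤ M) {s : ℝ}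
    (hs : 0 < s) (hMs : M * noiseLevel d δ σ L Lg ≤ s ^ 2) (hη : η = δ / M / s) (k : ℕ) :
    δ / M * ∫ ω, ‖∑ i ∈ Finset.range M, ∇ P.objective (ω (k * M + i + 1)).y‖
        ∂(runLaw P opt δ M η) ≤
      ∫ ω, P.objective (ω (k * M)).x ∂(runLaw P opt δ M η)
      - ∫ ω, P.objective (ω ((k + 1) * M)).x ∂(runLaw P opt δ M η)
      + 2 * M * (Lg * δ) * (δ / M) + 2 * (δ / M) * s := by
  have hM' : (0 : ℝ) < M := by exact_mod_cast hM
  set r := δ / M with hr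
  have hr0 : 0 < r := by positivity
  have hη0 : 0 < η := by rw [hη]; positivity
  have h1 := fun t => integral_inner_gradient_increment_run (opt := opt) (M := M) (η := η) hP hδ t
  have h2 := fun t => integral_inner_noise_eq_zero (opt := opt) (η := η) hP hδ hM (t := t)
    (Z := fun ω => increment M t (ω t)) (by fun_prop) (fun ω ω' h => by rw [h t le_rfl])
    (memLp_increment hδ t)
  have h3 := fun t => integral_norm_g_sq_run_le (opt := opt) (η := η) hP hδ hM t
  obtain ⟨h4, h4'⟩ := integral_norm_sum_noise_le (opt := opt) (η := η) hP hδ hM (k * M) M hs hMs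
  have hA₁ : Integrable (fun ω => ∑ i ∈ Finset.range M, inner ℝ
      (∇ P.objective (ω (k * M + i + 1)).y) (increment M (k * M + i) (ω (k * M + i))))
      (runLaw P opt δ M η) := integrable_finsetSum _ fun i _ => (h1 _).1
  have hA₂ : Integrable (fun ω => ∑ i ∈ Finset.range M, inner ℝ
      (noise P δ (ω (k * M + i + 1))) (increment M (k * M + i) (ω (k * M + i))))
      (runLaw P opt δ M η) := integrable_finsetSum _ fun i _ => (h2 _).1
  have hA₃ : Integrable (fun ω => ∑ i ∈ Finset.range M, ‖(ω (k * M + i + 1)).g‖ ^ 2)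
      (runLaw P opt δ M η) := integrable_finsetSum _ fun i _ => (h3 _).1
  have e₁ : ∫ ω, ∑ i ∈ Finset.range M, inner ℝ (∇ P.objective (ω (k * M + i + 1)).y)
      (increment M (k * M + i) (ω (k * M + i))) ∂(runLaw P opt δ M η) =
      ∫ ω, P.objective (ω ((k + 1) * M)).x ∂(runLaw P opt δ M η)
        - ∫ ω, P.objective (ω (k * M)).x ∂(runLaw P opt δ M η) := by
    rw [integral_finsetSum _ fun i _ => (h1 _).1]
    simp only [(h1 _).2]
    have := Finset.sum_range_sub
      (fun i => ∫ ω, P.objective (ω (k * M + i)).x ∂(runLaw P opt δ M η)) M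
    simp only [← add_assoc, add_zero, ← Nat.succ_mul] at this
    exact this
  have e₂ : ∫ ω, ∑ i ∈ Finset.range M, inner ℝ (noise P δ (ω (k * M + i + 1)))
      (increment M (k * M + i) (ω (k * M + i))) ∂(runLaw P opt δ M η) = 0 := by
    rw [integral_finsetSum _ fun i _ => (h2 _).1]
    exact Finset.sum_eq_zero fun i _ => (h2 _).2
  have e₃ : ∫ ω, ∑ i ∈ Finset.range M, ‖(ω (k * M + i + 1)).g‖ ^ 2 ∂(runLaw P opt δ M η)
      ≤ s ^ 2 := by
    rw [integral_finsetSum _ fun i _ => (h3 _).1]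
    refine le_trans ?_ hMs
    calc _ ≤ ∑ _i ∈ Finset.range M, noiseLevel d δ σ L Lg := by
          refine Finset.sum_le_sum fun i _ => (h3 _).2.trans ?_
          have : 0 ≤ (d / δ) ^ 2 * (σ ^ 2 + L ^ 2 * δ ^ 2) := by positivity
          rw [noiseLevel]
          nlinarith [sq_nonneg (L + Lg * δ)]
      _ = _ := by simp
  obtain ⟨hi, he⟩ := integral_linear_combination hA₁ hA₂ hA₃ h4
    (2 * M * (Lg * δ) * r + r ^ 2 / (2 * η)) (η / 2) r
  rw [← integral_const_mul]
  refine (integral_mono_ae ((integrable_norm_sum_gradient hP _ _).const_mul _) hi ?_).trans ?_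
  · filter_upwards [ae_run (P := P) (opt := opt) (δ := δ) (M := M) (η := η)] with ω hω
    have h := mul_norm_sum_le_of_regret (n := M) hr0.le (b := Lg * δ)
      (v := fun i => ∇ P.objective (ω (k * M + i + 1)).y)
      (G := fun i => smoothedGrad δ P.objective (ω (k * M + i + 1)).y)
      (g := fun i => (ω (k * M + i + 1)).g)
      (q := fun i => increment M (k * M + i) (ω (k * M + i)))
      (fun i _ => norm_increment_le hr0.le hω.2 _)
      (fun i _ => norm_smoothedGrad_sub_gradient_le hδ hP.diff hP.gradLip _)
      (fun u hu => block_regret hη0 hω.2 k hu)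
    simp only [noise]
    linarith
  · rw [he, e₁, e₂]
    -- The stepsize `η = r/s` balances the two regret terms at `r s / 2` each; the noise against the
    -- comparator costs another `r s`.
    have hr2 : r ^ 2 / (2 * η) = r * s / 2 := by rw [hη]; field_simp
    have hη2 : η / 2 * s ^ 2 = r * s / 2 := by rw [hη]; field_simp
    have h5 : η / 2 * ∫ ω, ∑ i ∈ Finset.range M, ‖(ω (k * M + i + 1)).g‖ ^ 2
        ∂(runLaw P opt δ M η) ≤ η / 2 * s ^ 2 := by gcongr
    have h6 : r * ∫ ω, ‖∑ i ∈ Finset.range M, noise P δ (ω (k * M + i + 1))‖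
        ∂(runLaw P opt δ M η) ≤ r * s := by gcongr
    linarith

/-- A reset affects the increment but not `x`, so the decreases of `f` telescope across blocks to at
most `γ`. Of the three `Lg δ`, two come from the estimator's bias and one from averaging the points.
-/
theorem sum_integral_norm_gradient_blockAverage_le (hP : P.Regular σ L Lg) (hδ : 0 < δ)
    (hM : 1 ≤ M) {s γ : ℝ} (hs : 0 < s) (hMs : M * noiseLevel d δ σ L Lg ≤ s ^ 2)
    (hη : η = δ / M / s) (hγ : ∀ x, P.objective 0 - P.objective x ≤ γ) (K : ℕ) :
    ∑ k ∈ Finset.range K, ∫ ω, ‖∇ P.objective (blockAverage M ω (k + 1))‖ ∂(runLaw P opt δ M η)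
      ≤ γ / δ + K * (3 * (Lg * δ) + 2 * s / M) := by
  have hM' : (0 : ℝ) < M := by exact_mod_cast hM
  have hg := hP.continuous_gradient.measurable
  set F : ℕ → ℝ := fun k => ∫ ω, P.objective (ω (k * M)).x ∂(runLaw P opt δ M η) with hF
  have hblock : ∀ k, ∫ ω, ‖∇ P.objective (blockAverage M ω (k + 1))‖ ∂(runLaw P opt δ M η)
      ≤ (F k - F (k + 1)) / δ + (3 * (Lg * δ) + 2 * s / M) := fun k => by
    have hi := integrable_norm_sum_gradient (opt := opt) (δ := δ) (M := M) (η := η) hP (k * M) M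
    have hm := measurable_blockAverage (d := d) M (k + 1)
    calc _ ≤ ∫ ω, (1 / M * ‖∑ i ∈ Finset.range M, ∇ P.objective (ω (k * M + i + 1)).y‖
          + Lg * (M * (δ / M))) ∂(runLaw P opt δ M η) := by
          refine integral_mono_ae (Integrable.of_bound
            (Measurable.aestronglyMeasurable (by fun_prop)) L (.of_forall fun ω => ?_))
            ((hi.const_mul _).add (integrable_const _)) ?_
          · rw [norm_norm]
            exact hP.norm_gradient_le _
          · filter_upwards [ae_run (P := P) (opt := opt) (δ := δ) (M := M) (η := η)] with ω hω
            exact norm_map_blockAverage_le hP.Lg_nonneg hP.gradLip hM (by positivity) hω.2 k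
      _ = 1 / δ * (δ / M * ∫ ω, ‖∑ i ∈ Finset.range M, ∇ P.objective (ω (k * M + i + 1)).y‖
          ∂(runLaw P opt δ M η)) + Lg * δ := by
          rw [integral_add (hi.const_mul _) (integrable_const _), integral_const_mul,
            integral_const]
          simp only [probReal_univ, one_smul]
          congr 1 <;> field_simp
      _ ≤ 1 / δ * (F k - F (k + 1) + 2 * M * (Lg * δ) * (δ / M) + 2 * (δ / M) * s)
          + Lg * δ := by
          gcongr
          exact integral_norm_sum_gradient_le hP hδ hM hs hMs hη k
      _ = _ := by field_simp; ring
  have hF0 : F 0 = P.objective 0 := by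
    simp only [hF, zero_mul]
    rw [integral_congr_ae (g := fun _ => P.objective 0), integral_const]
    · simp
    · filter_upwards [ae_run (P := P) (opt := opt) (δ := δ) (M := M) (η := η)] with ω hω
      rw [hω.1.1]
  have hFK : P.objective 0 - F K ≤ γ := by
    have : P.objective 0 - γ ≤ F K := by
      have h := integral_mono (integrable_const (P.objective 0 - γ))
        (integrable_objective_x (opt := opt) (M := M) (η := η) hP hδ (K * M)) fun ω => by
          linarith [hγ (ω (K * M)).x]
      simpa using h
    linarith
  refine (Finset.sum_le_sum fun k _ => hblock k).trans ?_
  rw [Finset.sum_add_distrib, ← Finset.sum_div, Finset.sum_range_sub', hF0]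
  simp only [Finset.sum_const, Finset.card_range, nsmul_eq_mul]
  gcongr

theorem integral_uniformOn_Icc (g : ℕ → ℝ) (K : ℕ) :
    ∫ k, g k ∂(uniformOn (Set.Icc 1 K)) = 1 / K * ∑ k ∈ Finset.range K, g (k + 1) := by
  rw [uniformOn, ProbabilityTheory.cond, integral_smul_measure]
  have e : (Set.Icc 1 K : Set ℕ) = ((Finset.Icc 1 K : Finset ℕ) : Set ℕ) := by simp
  have hi : IntegrableOn g (Finset.Icc 1 K : Finset ℕ) Measure.count := by
    rw [← e, ← Set.biUnion_of_singleton (Set.Icc 1 K),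
      integrableOn_finite_biUnion (Set.finite_Icc 1 K)]
    exact fun k _ => integrableOn_singleton (by simp) (by simp)
  rw [e, setIntegral_finset (Finset.Icc 1 K) hi, Measure.count_apply_finset]
  have e2 : Finset.Icc 1 K = (Finset.range K).image (· + 1) := by
    ext k
    simp only [Finset.mem_Icc, Finset.mem_image, Finset.mem_range]
    exact ⟨fun h => ⟨k - 1, by omega⟩, by rintro ⟨j, hj, rfl⟩; omega⟩
  simp only [Nat.card_Icc, Nat.add_sub_cancel, Measure.real, Measure.count_singleton]
  rw [e2, Finset.sum_image (by simp)]
  simp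

theorem integral_outputLaw_le (hP : P.Regular σ L Lg) (hδ : 0 < δ) (hM : 1 ≤ M) {K : ℕ}
    (hK : 1 ≤ K) {s γ : ℝ} (hs : 0 < s) (hMs : M * noiseLevel d δ σ L Lg ≤ s ^ 2)
    (hη : η = δ / M / s) (hγ : ∀ x, P.objective 0 - P.objective x ≤ γ) :
    Integrable (fun p => ‖∇ P.objective (blockAverage M p.1 p.2)‖)
      (outputLaw P opt δ M K η) ∧
    ∫ p, ‖∇ P.objective (blockAverage M p.1 p.2)‖ ∂(outputLaw P opt δ M K η)
      ≤ γ / (δ * K) + 3 * (Lg * δ) + 2 * s / M := by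
  have hK' : (0 : ℝ) < K := by exact_mod_cast hK
  have hg := hP.continuous_gradient.measurable
  have hprob : IsProbabilityMeasure (uniformOn (Set.Icc 1 K)) :=
    isProbabilityMeasure_uniformOn (Set.finite_Icc 1 K) ⟨1, by simpa using hK⟩
  have hm : Measurable fun p : (ℕ → State d) × ℕ => blockAverage M p.1 p.2 :=
    measurable_from_prod_countable_left fun k => measurable_blockAverage M k
  have hi : Integrable (fun p => ‖∇ P.objective (blockAverage M p.1 p.2)‖)
      (outputLaw P opt δ M K η) := by
    have : IsProbabilityMeasure (outputLaw P opt δ M K η) := by unfold outputLaw; infer_instance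
    refine Integrable.of_bound (Measurable.aestronglyMeasurable (by fun_prop)) L
      (.of_forall fun p => ?_)
    rw [norm_norm]
    exact hP.norm_gradient_le _
  refine ⟨hi, ?_⟩
  rw [outputLaw] at hi ⊢
  rw [integral_prod_symm _ hi, integral_uniformOn_Icc]
  have h := sum_integral_norm_gradient_blockAverage_le (opt := opt) hP hδ hM hs hMs hη hγ K
  calc _ ≤ 1 / K * (γ / δ + K * (3 * (Lg * δ) + 2 * s / M)) := by gcongr
    _ = _ := by field_simp; ring

theorem totalQueries_le (opt : Feedback) {T : ℕ} (hT : 1 ≤ T) : opt.totalQueries T ≤ 3 * T := by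
  cases opt <;>
  · simp only [Feedback.totalQueries, Feedback.initQueries, Feedback.roundQueries,
      Finset.sum_const, Nat.card_Icc, smul_eq_mul]
    omega

/-- With `δ = ε/(4 Lg)` the leading factor `(d/δ)²` is `16 Lg² d²/ε²`. The remaining powers of `ε`
are bounded by those of `ε₀`, and `d² ≥ 1` absorbs the term free of `d`. -/
theorem noiseLevel_le {ε ε₀ : ℝ} (d : ℕ) [NeZero d] (hε : 0 < ε) (hεε₀ : ε ≤ ε₀) (hL : 0 ≤ L)
    (hLg : 0 < Lg) :
    noiseLevel d (ε / (4 * Lg)) σ L Lg ≤ d ^ 2 / ε ^ 2 *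
      (48 * (16 * Lg ^ 2 * σ ^ 2 + L ^ 2 * ε₀ ^ 2) + 2 * (L + ε₀ / 4) ^ 2 * ε₀ ^ 2) := by
  have hd : (1 : ℝ) ≤ d := by exact_mod_cast Nat.one_le_iff_ne_zero.mpr (NeZero.ne d)
  have hd2 : (1 : ℝ) ≤ d ^ 2 := one_le_pow₀ hd
  have e1 : noiseLevel d (ε / (4 * Lg)) σ L Lg = 1 / ε ^ 2 * (d ^ 2 *
      (48 * (16 * Lg ^ 2 * σ ^ 2 + L ^ 2 * ε ^ 2)) + 2 * (L + ε / 4) ^ 2 * ε ^ 2) := by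
    rw [noiseLevel]; field_simp; ring
  have h2 : 2 * (L + ε / 4) ^ 2 * ε ^ 2 ≤ d ^ 2 * (2 * (L + ε₀ / 4) ^ 2 * ε₀ ^ 2) := by
    refine le_trans ?_ (le_mul_of_one_le_left (by positivity) hd2)
    gcongr
  rw [e1]
  calc _ ≤ 1 / ε ^ 2 * (d ^ 2 * (48 * (16 * Lg ^ 2 * σ ^ 2 + L ^ 2 * ε₀ ^ 2))
        + d ^ 2 * (2 * (L + ε₀ / 4) ^ 2 * ε₀ ^ 2)) := by gcongr
    _ = _ := by ring

end Convergence

end ZOO2NC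

end

/-! ### Choice of the parameters. -/

theorem theorem4p2 (γ σ L Lg ε₀ : ℝ) (hγ : 0 ≤ γ) (hσ : 0 ≤ σ) (hL : 0 ≤ L) (hLg : 0 < Lg)
    (hε₀ : 0 < ε₀) :
    ∃ C : ℝ, 0 < C ∧
      ∀ (opt : ZOO2NC.Feedback) (d : ℕ) [NeZero d] (ε : ℝ), 0 < ε → ε ≤ ε₀ →
        ∃ (M K : ℕ) (η : ℝ), 1 ≤ M ∧ 1 ≤ K ∧ 0 < η ∧
          (opt.totalQueries (K * M) : ℝ) ≤ C * (d : ℝ) ^ 2 / ε ^ 6 ∧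
          ∀ (S : Type*) [MeasurableSpace S] (P : ZOO2NC.Problem d S),
            P.OracleVarianceLE σ →
            BddBelow (Set.range P.objective) →
            P.objective 0 - (⨅ x, P.objective x) ≤ γ →
            (∀ x y, |P.objective x - P.objective y| ≤ L * ‖x - y‖) →
            Differentiable ℝ P.objective →
            (∀ x y, ‖∇ P.objective x - ∇ P.objective y‖ ≤ Lg * ‖x - y‖) →
            Integrable (fun p => ‖∇ P.objective (ZOO2NC.blockAverage M p.1 p.2)‖)
                (ZOO2NC.outputLaw P opt (ε / (4 * Lg)) M K η) ∧
              ∫ p, ‖∇ P.objective (ZOO2NC.blockAverage M p.1 p.2)‖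
                ∂(ZOO2NC.outputLaw P opt (ε / (4 * Lg)) M K η) ≤ ε := by
  set A : ℝ := 48 * (16 * Lg ^ 2 * σ ^ 2 + L ^ 2 * ε₀ ^ 2) + 2 * (L + ε₀ / 4) ^ 2 * ε₀ ^ 2 with hA
  have hA0 : 0 < A := by positivity
  -- The two factors bound `M ε⁴/d²` and `K ε²`, with the powers of `ε₀` absorbing the rounding; the
  -- 3 covers the query count of both options.
  refine ⟨3 * ((256 * A + ε₀ ^ 4) * (32 * γ * Lg + 2 * ε₀ ^ 2)), by positivity, ?_⟩
  intro opt d _ ε hε hεε₀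
  have hd : (1 : ℝ) ≤ d := by exact_mod_cast Nat.one_le_iff_ne_zero.mpr (NeZero.ne d)
  have hd2 : (1 : ℝ) ≤ d ^ 2 := one_le_pow₀ hd
  -- With `s = M ε / 16` the term `2s/M` is `ε/8`, and `M V ≤ s²` follows from `V ≤ A d²/ε²` once `M
  -- ≥ 256 A d²/ε⁴`.
  set M := ⌈256 * A * d ^ 2 / ε ^ 4⌉₊ with hMdef
  -- Chosen so that `γ/(δK) = 4 Lg γ/(εK)` is at most `ε/8`; the added 1 keeps `K` positive when `γ
  -- = 0`.
  set K := ⌈32 * γ * Lg / ε ^ 2⌉₊ + 1 with hKdef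
  have hM : 1 ≤ M := Nat.ceil_pos.mpr (by positivity)
  have hK : 1 ≤ K := Nat.le_add_left _ _
  have hM' : (0 : ℝ) < M := by exact_mod_cast hM
  have hK' : (0 : ℝ) < K := by exact_mod_cast hK
  have hMle : 256 * A * d ^ 2 / ε ^ 4 ≤ M := Nat.le_ceil _
  have hKle : 32 * γ * Lg / ε ^ 2 ≤ K := by
    rw [hKdef]; push_cast
    linarith [Nat.le_ceil (32 * γ * Lg / ε ^ 2)]
  have hs : 0 < M * ε / 16 := by positivity
  refine ⟨M, K, ε / (4 * Lg) / M / (M * ε / 16), hM, hK, by positivity, ?_, ?_⟩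
  · have hMge : (M : ℝ) ≤ d ^ 2 * (256 * A + ε₀ ^ 4) / ε ^ 4 := by
      calc (M : ℝ) ≤ 256 * A * d ^ 2 / ε ^ 4 + 1 := (Nat.ceil_lt_add_one (by positivity)).le
        _ = (256 * A * d ^ 2 + 1 * ε ^ 4) / ε ^ 4 := by field_simp
        _ ≤ (256 * A * d ^ 2 + d ^ 2 * ε₀ ^ 4) / ε ^ 4 := by gcongr
        _ = _ := by ring
    have hKge : (K : ℝ) ≤ (32 * γ * Lg + 2 * ε₀ ^ 2) / ε ^ 2 := by
      calc (K : ℝ) ≤ 32 * γ * Lg / ε ^ 2 + 1 + 1 := by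
            rw [hKdef]; push_cast
            linarith [(Nat.ceil_lt_add_one (a := 32 * γ * Lg / ε ^ 2) (by positivity)).le]
        _ = (32 * γ * Lg + 2 * ε ^ 2) / ε ^ 2 := by field_simp; ring
        _ ≤ _ := by gcongr
    calc (opt.totalQueries (K * M) : ℝ) ≤ 3 * (K * M) := by
          exact_mod_cast ZOO2NC.totalQueries_le opt (Nat.mul_pos hK hM)
      _ ≤ 3 * ((32 * γ * Lg + 2 * ε₀ ^ 2) / ε ^ 2 * (d ^ 2 * (256 * A + ε₀ ^ 4) / ε ^ 4)) := by
          gcongr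
      _ = _ := by field_simp
  · intro S _ P hvar hbdd hgap hlip hdiff hgrad
    have hP : P.Regular σ L Lg := ⟨hvar, hlip, hdiff, hgrad⟩
    have hMs : M * ZOO2NC.noiseLevel d (ε / (4 * Lg)) σ L Lg ≤ (M * ε / 16) ^ 2 := by
      calc _ ≤ M * (d ^ 2 / ε ^ 2 * A) := by
            gcongr
            exact ZOO2NC.noiseLevel_le d hε hεε₀ hL hLg
        _ = M * (ε ^ 2 / 256) * (256 * A * d ^ 2 / ε ^ 4) := by field_simp
        _ ≤ M * (ε ^ 2 / 256) * M := by gcongr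
        _ = _ := by ring
    obtain ⟨h1, h2⟩ := ZOO2NC.integral_outputLaw_le (opt := opt) hP (by positivity) hM hK hs hMs rfl
      (γ := γ) fun x => by linarith [ciInf_le hbdd x]
    refine ⟨h1, h2.trans ?_⟩
    have e1 : γ / (ε / (4 * Lg) * K) ≤ ε / 8 := by
      rw [div_le_iff₀ (by positivity)]
      calc γ = ε / 8 * (ε / (4 * Lg) * (32 * γ * Lg / ε ^ 2)) := by field_simp; ring
        _ ≤ _ := by gcongr
    have e2 : 3 * (Lg * (ε / (4 * Lg))) = 3 * ε / 4 := by field_simp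
    have e3 : 2 * (M * ε / 16) / M = ε / 8 := by field_simp; norm_num
    linarith
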